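/- **Notation.** $\gamma$ is the Euler–Mascheroni constant, $\psi=\Gamma'/\Gamma$ the digamma function, $\zeta$ the Riemann zeta function, $Li_m(x)=\sum_{k\ge1}x^k/k^m$, $H_n^{(r)}=\sum_{k=1}^n 1/k^r$, $H_n=H_n^{(1)}$, $H_0=0$, and $\binom{s}{t}=\frac{\Gamma(s+1)}{\Gamma(t+1)\Gamma(s-t+1)}$. **Theorem.** (i) Let $s\in\mathbb{R}$ be not a negative integer, and let $a>0$. The two series below converge, and the integral $\int_0^1\frac{1-x^s}{1-x}\log^2(x+a)\,dx$ converges (absolutely) if and only if $s>-1$, or $a=1$ and $s>-3$. Whenever it converges, $$\begin{aligned} \int_{0}^{1}\frac{1-x^s}{1-x}\log^2(x+a)\,dx={}&(\gamma+\psi(s+1))\log^2(a+1)+2\zeta(3)-\log(a+1)\log^2\Big(\frac{a}{a+1}\Big)\\ &-2\log(a+1)Li_2\Big(\frac{1}{a+1}\Big)+2\log\Big(\frac{a}{a+1}\Big)Li_2\Big(\frac{a}{a+1}\Big)-2Li_3\Big(\frac{a}{a+1}\Big)\\ &+2\log(a+1)\sum_{k=1}^{\infty}\frac{1}{k^2(a+1)^k\binom{s+k}{k}}-2\sum_{k=1}^{\infty}\frac{H_{k-1}}{k^2(a+1)^k\binom{s+k}{k}}.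 \end{aligned}$$ (ii) Let $a\ge2$ be real and let $n\ge0$ be an integer. Then the integral and the series below converge absolutely, and $$\begin{aligned} \int_{0}^{1}\frac{1-x^n}{1-x}\log^2(a-x)\,dx={}&H_n\log^2(a-1)+2\zeta(3)-2H_n^{(2)}\log(a-1)\\ &-2\log(a-1)\sum_{k=1}^{n}\frac{(H_k+H_{n-k}-H_n)a^k}{k}-\log(a-1)\log^2\Big(\frac{a}{a-1}\Big)\\ &-\frac{2}{3}\log^3\Big(\frac{a}{a-1}\Big)-2Li_3\Big(\frac{a-1}{a}\Big)-2\log\Big(\frac{a}{a-1}\Big)Li_2\Big(\frac{a-1}{a}\Big)\\ &-\sum_{k=1}^{\infty}\frac{2(-1)^kH_{k-1}}{k^2(a-1)^k\binom{n+k}{k}}+2\log(a-1)\log\Big(\frac{a}{a-1}\Big)\sum_{k=1}^{n}\frac{a^k}{k}. \end{aligned}$$ -/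

import Mathlib

open MeasureTheory

noncomputable section

/-- The polylogarithm `Li_n(x) = ∑_{k ≥ 1} x ^ k / k ^ n` of a real argument (the series is indexed
from `k = 0`, with `k + 1` in place of `k`). -/
def polylog (n : ℕ) (x : ℝ) : ℝ :=
  ∑' k : ℕ, x ^ (k + 1) / ((k : ℝ) + 1) ^ n

/-- The real digamma function `ψ(x) = Γ'(x) / Γ(x)`. -/
def digamma (x : ℝ) : ℝ :=
  deriv Real.Gamma x / Real.Gamma x

/-- The generalized binomial coefficient `Γ(s + 1) / (Γ(t + 1) Γ(s - t + 1))`. -/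
def genBinom (s t : ℝ) : ℝ :=
  Real.Gamma (s + 1) / (Real.Gamma (t + 1) * Real.Gamma (s - t + 1))

/-- The generalized harmonic number `H_n^{(r)} = ∑_{k=1}^n 1 / k ^ r`. -/
def genHarmonic (r n : ℕ) : ℝ :=
  ∑ k ∈ Finset.Icc 1 n, 1 / (k : ℝ) ^ r

/-- The harmonic number `H_n = H_n^{(1)} = ∑_{k=1}^n 1 / k`. -/
def H (n : ℕ) : ℝ := genHarmonic 1 n

/-- The value `ζ(3)` of the Riemann zeta function (a real number). -/
def zetaThree : ℝ := (riemannZeta 3).re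

/-- The term of index `k + 1` of the series `∑_{k ≥ 1} 1 / (k² (a+1)^k C(s+k, k))`. -/
def binomTerm (s a : ℝ) (k : ℕ) : ℝ :=
  1 / (((k : ℝ) + 1) ^ 2 * (a + 1) ^ (k + 1) * genBinom (s + (k + 1)) (k + 1))

/-- The term of index `k + 1` of the series `∑_{k ≥ 1} H_{k-1} / (k² (a+1)^k C(s+k, k))`. -/
def harmonicBinomTerm (s a : ℝ) (k : ℕ) : ℝ :=
  H k / (((k : ℝ) + 1) ^ 2 * (a + 1) ^ (k + 1) * genBinom (s + (k + 1)) (k + 1))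

/-- The term of index `k + 1` of the series
`∑_{k ≥ 1} 2 (-1)^k H_{k-1} / (k² (a-1)^k C(n+k, k))`, where `n` is a natural number. -/
def altHarmonicBinomTerm (n : ℕ) (a : ℝ) (k : ℕ) : ℝ :=
  2 * (-1) ^ (k + 1) * H k /
    (((k : ℝ) + 1) ^ 2 * (a - 1) ^ (k + 1) * ((n + (k + 1)).choose (k + 1) : ℝ))

end

/-!
Both formulas come from expanding the logarithm in powers of `u = 1 - x` and integrating term by
term. Write `f` for the squared logarithm, `f = c₀ + ∑_{k ≥ 1} cₖ uᵏ`. The constant term contributes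
`c₀ ∫₀¹ (1 - x ^ s) / (1 - x) dx = c₀ (γ + ψ(s + 1))` (`integral_digammaKernel`). In the other terms
the factor `u` cancels the denominator, and the moments `∫₀¹ x ^ s u ^ k dx = k! Γ(s+1) / Γ(s+k+2)`
(`betaMoment`) turn them into `∑ c_{k+1} / (k + 1)`, which is independent of `s`, minus
`∑ c_{k+1} betaMoment k s`, which is the series with the binomial coefficients
(`integral_digammaKernel_mul_powerSeries`). The coefficients of `log² (1 - z)` are harmonic numbers
(`hasSum_log_sq`), and the sum independent of `s` is an integral of `log² (1 ± t) / t`, whose closed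
form in `Li₂` and `Li₃` is checked by differentiation (`integral_log_one_sub_sq_div`,
`integral_log_one_add_sq_div`).

Integrability against the kernel is integrability of `x ^ s log² (x + a)` at `0`
(`integrableOn_digammaKernel_mul_iff`): `log² (x + a)` has a nonzero limit there unless `a = 1`, when
it is of the order of `x²`. For `a = 1` and `-3 < s < -1` the formula is reached by a recurrence. Both
sides change by a moment of `x ^ s` when `s` is replaced by `s + 1`
(`GeomBounded.digammaSeries_eq`), and the moment formula itself continues below `s = -1` because the
double zero of `log² (1 + x)` at `x = 0` allows the power series in `u` to be divided by `1 - u` twice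
(`GeomBounded.integral_rpow_mul_of_zero`).

For `log (a - x)` only the part `log² ((a - x) / (a - 1))` is expanded; its series still converges
well enough at `a = 2`, since `H_k / k²` is summable. The part linear in
`log ((a - x) / (a - 1))` has an elementary value, found by induction on `n` from an integration by
parts (`integral_digammaKernel_mul_log_sub`).
-/

/-! ### Beta moments -/

/-- The value `k! Γ(s+1) / Γ(s+k+2)` of the beta function at `(s + 1, k + 1)`, that is
`∫₀¹ x ^ s (1 - x) ^ k dx` for `s > -1`, continued to all `s` that are not negative integers. -/
noncomputable def betaMoment (k : ℕ) (s : ℝ) : ℝ :=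
  k.factorial * Real.Gamma (s + 1) / Real.Gamma (s + k + 2)

/-- The kernel `(1 - x ^ s) / (1 - x)`, whose integral over `(0, 1)` is `γ + ψ(s + 1)`. -/
noncomputable def digammaKernel (s x : ℝ) : ℝ := (1 - x ^ s) / (1 - x)

/-- `s` is not a negative integer. -/
def NotNegInt (s : ℝ) : Prop := ∀ m : ℕ, 1 ≤ m → s ≠ -(m : ℝ)

theorem NotNegInt.add_one {s : ℝ} (hs : NotNegInt s) : NotNegInt (s + 1) := by
  intro m _ h
  exact hs (m + 1) (by omega) (by push_cast; linarith)

theorem NotNegInt.add_one_ne_zero {s : ℝ} (hs : NotNegInt s) : s + 1 ≠ 0 := by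
  intro h
  exact hs 1 le_rfl (by push_cast; linarith)

theorem NotNegInt.add_ne_neg_nat {s : ℝ} (hs : NotNegInt s) (k m : ℕ) : s + k + 1 ≠ -(m : ℝ) := by
  intro h
  exact hs (m + k + 1) (by omega) (by push_cast; linarith)

theorem notNegInt_of_neg_one_lt {s : ℝ} (hs : -1 < s) : NotNegInt s := by
  intro m hm h
  have : (1 : ℝ) ≤ m := by exact_mod_cast hm
  linarith

theorem NotNegInt.gamma_ne_zero {s : ℝ} (hs : NotNegInt s) (k : ℕ) :
    Real.Gamma (s + k + 1) ≠ 0 :=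
  Real.Gamma_ne_zero fun m => hs.add_ne_neg_nat k m

theorem betaMoment_zero {s : ℝ} (hs : NotNegInt s) : betaMoment 0 s = 1 / (s + 1) := by
  have h0 := hs.add_one_ne_zero
  have h1 : Real.Gamma (s + 1) ≠ 0 := by simpa using hs.gamma_ne_zero 0
  have h2 : Real.Gamma (s + 2) = (s + 1) * Real.Gamma (s + 1) := by
    rw [← Real.Gamma_add_one h0]; ring_nf
  simp only [betaMoment, Nat.factorial_zero, Nat.cast_one, Nat.cast_zero, add_zero, one_mul]
  rw [h2]
  field_simp

theorem betaMoment_succ_right {s : ℝ} (hs : NotNegInt s) (k : ℕ) :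
    betaMoment k (s + 1) = betaMoment k s * ((s + 1) / (s + k + 2)) := by
  have h1 : Real.Gamma (s + 1 + 1) = (s + 1) * Real.Gamma (s + 1) :=
    Real.Gamma_add_one hs.add_one_ne_zero
  have h3 : s + k + 2 ≠ 0 := by
    have := hs.add_ne_neg_nat (k + 1) 0
    push_cast at this
    intro h; apply this; linarith
  have h2 : Real.Gamma (s + 1 + k + 2) = (s + k + 2) * Real.Gamma (s + k + 2) := by
    rw [← Real.Gamma_add_one h3]; ring_nf
  have h4 : Real.Gamma (s + k + 2) ≠ 0 := by
    have := hs.gamma_ne_zero (k + 1)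
    push_cast at this
    convert this using 2; ring
  simp only [betaMoment]
  rw [h1, h2]
  field_simp

theorem betaMoment_succ_left {s : ℝ} (hs : NotNegInt s) (k : ℕ) :
    betaMoment (k + 1) s = betaMoment k s - betaMoment k (s + 1) := by
  have h3 : s + k + 2 ≠ 0 := by
    have := hs.add_ne_neg_nat (k + 1) 0
    push_cast at this
    intro h; apply this; linarith
  have h2 : Real.Gamma (s + (k + 1 : ℕ) + 2) = (s + k + 2) * Real.Gamma (s + k + 2) := by
    rw [← Real.Gamma_add_one h3]; push_cast; ring_nf
  have h4 : Real.Gamma (s + k + 2) ≠ 0 := by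
    have := hs.gamma_ne_zero (k + 1)
    push_cast at this
    convert this using 2; ring
  rw [betaMoment_succ_right hs]
  simp only [betaMoment]
  rw [h2, Nat.factorial_succ]
  push_cast
  field_simp
  ring

theorem betaMoment_nat_zero (k : ℕ) : betaMoment k 0 = 1 / ((k : ℝ) + 1) := by
  have h : Real.Gamma (0 + k + 2) = (k + 1).factorial := by
    rw [← Real.Gamma_nat_eq_factorial]; push_cast; ring_nf
  rw [betaMoment, h, zero_add, Real.Gamma_one, Nat.factorial_succ]
  have : (k.factorial : ℝ) ≠ 0 := by exact_mod_cast k.factorial_ne_zero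
  push_cast
  field_simp

/-- Passing from `s + 1` to `s` costs one factor of `k`, which yields polynomial growth in `k`. -/
theorem abs_betaMoment_le_of_succ {s : ℝ} (hs : NotNegInt s) :
    ∃ C : ℝ, 0 ≤ C ∧ ∀ k : ℕ, |betaMoment k s| ≤ C * (k + 1) * |betaMoment k (s + 1)| := by
  have h0 := hs.add_one_ne_zero
  refine ⟨(|s| + 2) / |s + 1|, by positivity, fun k => ?_⟩
  have h3 : s + k + 2 ≠ 0 := by
    have := hs.add_ne_neg_nat (k + 1) 0
    push_cast at this
    intro h; apply this; linarith
  rw [betaMoment_succ_right hs, abs_mul, abs_div]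
  have h4 : |s + k + 2| ≤ (|s| + 2) * (k + 1) := by
    have := abs_nonneg s
    have hk : (0 : ℝ) ≤ k := k.cast_nonneg
    calc |s + k + 2| = |s + (k + 2)| := by ring_nf
      _ ≤ |s| + |(k : ℝ) + 2| := abs_add_le _ _
      _ = |s| + (k + 2) := by rw [abs_of_pos (by positivity : (0 : ℝ) < (k : ℝ) + 2)]
      _ ≤ _ := by nlinarith
  have h5 : 0 < |s + k + 2| := abs_pos.mpr h3
  have h6 : 0 < |s + 1| := abs_pos.mpr h0
  calc |betaMoment k s| = |betaMoment k s| * 1 := by ring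
    _ ≤ |betaMoment k s| * ((|s| + 2) * (k + 1) / |s + k + 2|) := by
        gcongr; rwa [one_le_div h5]
    _ = _ := by field_simp

/-! ### Moments of `x ^ s` -/

theorem integrableOn_rpow {s : ℝ} (hs : -1 < s) :
    IntegrableOn (fun x : ℝ => x ^ s) (Set.Ioo 0 1) :=
  (intervalIntegral.integrableOn_Ioo_rpow_iff one_pos).2 hs

theorem integrableOn_rpow_mul_continuousOn {s : ℝ} (hs : -1 < s) {g : ℝ → ℝ}
    (hg : ContinuousOn g (Set.Icc 0 1)) :
    IntegrableOn (fun x : ℝ => x ^ s * g x) (Set.Ioo 0 1) := by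
  have h := integrableOn_rpow hs
  rw [← integrableOn_Icc_iff_integrableOn_Ioo] at h ⊢
  exact h.mul_continuousOn hg isCompact_Icc

theorem integral_rpow_mul_one_sub_pow {s : ℝ} (hs : -1 < s) (k : ℕ) :
    ∫ x in Set.Ioo (0 : ℝ) 1, x ^ s * (1 - x) ^ k = betaMoment k s := by
  induction k generalizing s with
  | zero =>
    rw [betaMoment_zero (notNegInt_of_neg_one_lt hs)]
    simp only [pow_zero, mul_one]
    rw [← integral_Ioc_eq_integral_Ioo, ← intervalIntegral.integral_of_le zero_le_one,
      integral_rpow (Or.inl hs), Real.one_rpow, Real.zero_rpow (by linarith)]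
    ring
  | succ k ih =>
    rw [betaMoment_succ_left (notNegInt_of_neg_one_lt hs), ← ih hs, ← ih (by linarith : -1 < s + 1),
      ← integral_sub]
    · refine setIntegral_congr_fun measurableSet_Ioo fun x hx => ?_
      rw [Real.rpow_add_one hx.1.ne']
      ring
    · exact integrableOn_rpow_mul_continuousOn hs (by fun_prop)
    · exact integrableOn_rpow_mul_continuousOn (by linarith) (by fun_prop)

theorem betaMoment_nonneg {s : ℝ} (hs : -1 < s) (k : ℕ) : 0 ≤ betaMoment k s := by
  rw [← integral_rpow_mul_one_sub_pow hs]
  refine setIntegral_nonneg measurableSet_Ioo fun x hx => ?_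
  have := hx.1; have := hx.2
  have h1 : 0 ≤ 1 - x := by linarith
  positivity

theorem betaMoment_le {s : ℝ} (hs : -1 < s) (k : ℕ) : betaMoment k s ≤ 1 / (s + 1) := by
  rw [← betaMoment_zero (notNegInt_of_neg_one_lt hs)]
  rw [← integral_rpow_mul_one_sub_pow hs, ← integral_rpow_mul_one_sub_pow hs]
  refine setIntegral_mono_on (integrableOn_rpow_mul_continuousOn hs (by fun_prop))
    (integrableOn_rpow_mul_continuousOn hs (by fun_prop)) measurableSet_Ioo fun x hx => ?_
  have := hx.1; have := hx.2
  have h1 : (1 - x) ^ k ≤ 1 := pow_le_one₀ (by linarith) (by linarith)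
  have h2 : 0 ≤ x ^ s := by positivity
  rw [pow_zero]
  gcongr

theorem betaMoment_le_of_nonneg {s : ℝ} (hs : 0 ≤ s) (k : ℕ) :
    betaMoment k s ≤ 1 / ((k : ℝ) + 1) := by
  rw [← betaMoment_nat_zero]
  rw [← integral_rpow_mul_one_sub_pow (by linarith : -1 < s),
    ← integral_rpow_mul_one_sub_pow (by norm_num : (-1 : ℝ) < 0)]
  refine setIntegral_mono_on (integrableOn_rpow_mul_continuousOn (by linarith) (by fun_prop))
    (integrableOn_rpow_mul_continuousOn (by norm_num) (by fun_prop)) measurableSet_Ioo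
    fun x hx => ?_
  have := hx.1; have := hx.2
  have h1 : 0 ≤ (1 - x) := by linarith
  rw [Real.rpow_zero]
  have := Real.rpow_le_one hx.1.le hx.2.le hs
  gcongr

theorem abs_betaMoment_le {s : ℝ} (hs : NotNegInt s) :
    ∃ (C : ℝ) (m : ℕ), 0 ≤ C ∧ ∀ k : ℕ, |betaMoment k s| ≤ C * ((k : ℝ) + 1) ^ m := by
  obtain ⟨N, hN⟩ := exists_nat_gt (-1 - s)
  induction N generalizing s with
  | zero =>
    have h1 : -1 < s := by simp at hN; linarith
    have h2 : (0 : ℝ) < s + 1 := by linarith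
    refine ⟨1 / (s + 1), 0, by positivity, fun k => ?_⟩
    rw [abs_of_nonneg (betaMoment_nonneg h1 k), pow_zero, mul_one]
    exact betaMoment_le h1 k
  | succ N ih =>
    obtain ⟨C, m, hC, h⟩ := ih hs.add_one (by push_cast at hN; linarith)
    obtain ⟨C', hC', h'⟩ := abs_betaMoment_le_of_succ hs
    refine ⟨C' * C, m + 1, by positivity, fun k => (h' k).trans ?_⟩
    calc C' * ((k : ℝ) + 1) * |betaMoment k (s + 1)|
        ≤ C' * ((k : ℝ) + 1) * (C * ((k : ℝ) + 1) ^ m) := by gcongr; exact h k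
      _ = _ := by ring

/-! ### Integrability against the digamma kernel -/

theorem digammaKernel_eq_add_one_sub {s x : ℝ} (hx : x ∈ Set.Ioo (0 : ℝ) 1) :
    digammaKernel s x = digammaKernel (s + 1) x - x ^ s := by
  have h : 1 - x ≠ 0 := by linarith [hx.2]
  rw [digammaKernel, digammaKernel, Real.rpow_add_one hx.1.ne']
  field_simp
  ring

theorem continuousOn_rpow_Ioo (s : ℝ) : ContinuousOn (fun x : ℝ => x ^ s) (Set.Ioo 0 1) :=
  fun x hx => (Real.continuousAt_rpow_const x s (Or.inl hx.1.ne')).continuousWithinAt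

theorem continuousOn_digammaKernel (s : ℝ) :
    ContinuousOn (digammaKernel s) (Set.Ioo 0 1) :=
  (continuousOn_const.sub (continuousOn_rpow_Ioo s)).div (by fun_prop)
    fun x hx => by linarith [hx.2]

theorem rpow_le_one_add_abs_digammaKernel {s x : ℝ} (hx : x ∈ Set.Ioo (0 : ℝ) 1) :
    x ^ s ≤ 1 + |digammaKernel s x| := by
  have h : 0 < 1 - x := by linarith [hx.2]
  have h1 : |1 - x ^ s| ≤ |digammaKernel s x| := by
    rw [digammaKernel, abs_div, abs_of_pos h, le_div_iff₀ h]
    have := abs_nonneg (1 - x ^ s)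
    nlinarith [hx.1]
  have := neg_abs_le (1 - x ^ s)
  linarith

theorem integrableOn_digammaKernel_mul_of_one_le {p : ℝ} (hp : 1 ≤ p) {g : ℝ → ℝ}
    (hg : ContinuousOn g (Set.Icc 0 1)) :
    IntegrableOn (fun x => digammaKernel p x * g x) (Set.Ioo 0 1) := by
  have hgi : IntegrableOn g (Set.Ioo 0 1) :=
    (hg.integrableOn_compact isCompact_Icc).mono_set Set.Ioo_subset_Icc_self
  refine hgi.bdd_mul (c := p)
    ((continuousOn_digammaKernel p).aestronglyMeasurable measurableSet_Ioo) ?_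
  filter_upwards [ae_restrict_mem measurableSet_Ioo] with x hx
  have h : 0 < 1 - x := by linarith [hx.2]
  have h1 : x ^ p ≤ 1 := Real.rpow_le_one hx.1.le hx.2.le (by linarith)
  have h2 := one_add_mul_self_le_rpow_one_add (s := x - 1) (by linarith [hx.1]) hp
  rw [add_sub_cancel] at h2
  rw [digammaKernel, Real.norm_eq_abs, abs_of_nonneg (div_nonneg (by linarith) h.le),
    div_le_iff₀ h]
  linarith

/-- Near `x = 1` the kernel is bounded and near `x = 0` it is of the order of `1 + x ^ s`, so
integrability against it is integrability against `x ^ s`. -/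
theorem integrableOn_digammaKernel_mul_iff (s : ℝ) {g : ℝ → ℝ}
    (hg : ContinuousOn g (Set.Icc 0 1)) :
    IntegrableOn (fun x => digammaKernel s x * g x) (Set.Ioo 0 1) ↔
      IntegrableOn (fun x => x ^ s * g x) (Set.Ioo 0 1) := by
  have hgo : ContinuousOn g (Set.Ioo 0 1) := hg.mono Set.Ioo_subset_Icc_self
  have hgi : IntegrableOn g (Set.Ioo 0 1) :=
    (hg.integrableOn_compact isCompact_Icc).mono_set Set.Ioo_subset_Icc_self
  constructor
  · intro h
    refine Integrable.mono' (h.norm.add hgi.norm)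
      (((continuousOn_rpow_Ioo s).mul hgo).aestronglyMeasurable measurableSet_Ioo) ?_
    filter_upwards [ae_restrict_mem measurableSet_Ioo] with x hx
    have h1 := rpow_le_one_add_abs_digammaKernel (s := s) hx
    have h2 : 0 ≤ x ^ s := Real.rpow_nonneg hx.1.le s
    simp only [Pi.add_apply, Real.norm_eq_abs, abs_mul, abs_of_nonneg h2]
    have := abs_nonneg (g x)
    nlinarith
  · obtain ⟨N, hN⟩ := exists_nat_ge (1 - s)
    induction N generalizing s with
    | zero =>
      intro _
      exact integrableOn_digammaKernel_mul_of_one_le (by simp at hN; linarith) hg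
    | succ N ih =>
      intro h
      have h1 : IntegrableOn (fun x => x ^ (s + 1) * g x) (Set.Ioo 0 1) := by
        refine Integrable.mono' h.norm
          (((continuousOn_rpow_Ioo _).mul hgo).aestronglyMeasurable measurableSet_Ioo) ?_
        filter_upwards [ae_restrict_mem measurableSet_Ioo] with x hx
        rw [Real.rpow_add_one hx.1.ne', norm_mul, norm_mul, norm_mul]
        have h2 : ‖x‖ ≤ 1 := by rw [Real.norm_eq_abs, abs_of_pos hx.1]; exact hx.2.le
        gcongr
        exact mul_le_of_le_one_right (norm_nonneg _) h2
      refine ((ih (s + 1) (by push_cast at hN; linarith) h1).sub h).congr_fun ?_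
        measurableSet_Ioo
      intro x hx
      simp only [Pi.sub_apply]
      rw [digammaKernel_eq_add_one_sub (s := s) hx]
      ring

theorem integrableOn_digammaKernel_mul {s : ℝ} (hs : -1 < s) {g : ℝ → ℝ}
    (hg : ContinuousOn g (Set.Icc 0 1)) :
    IntegrableOn (fun x => digammaKernel s x * g x) (Set.Ioo 0 1) :=
  (integrableOn_digammaKernel_mul_iff s hg).2 (integrableOn_rpow_mul_continuousOn hs hg)

theorem integrableOn_digammaKernel {s : ℝ} (hs : -1 < s) :
    IntegrableOn (digammaKernel s) (Set.Ioo 0 1) := by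
  simpa using integrableOn_digammaKernel_mul hs (g := fun _ => 1) continuousOn_const

/-- `∫ h_s g = ∫ h_{s+1} g - ∫ x ^ s g` for the digamma kernel `h`. -/
theorem integral_digammaKernel_mul_eq_add_one_sub {s : ℝ} {g : ℝ → ℝ}
    (h1 : IntegrableOn (fun x => digammaKernel (s + 1) x * g x) (Set.Ioo 0 1))
    (h2 : IntegrableOn (fun x => x ^ s * g x) (Set.Ioo 0 1)) :
    ∫ x in Set.Ioo (0 : ℝ) 1, digammaKernel s x * g x =
      (∫ x in Set.Ioo (0 : ℝ) 1, digammaKernel (s + 1) x * g x) -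
        ∫ x in Set.Ioo (0 : ℝ) 1, x ^ s * g x := by
  rw [← integral_sub h1 h2]
  refine setIntegral_congr_fun measurableSet_Ioo fun x hx => ?_
  rw [digammaKernel_eq_add_one_sub (s := s) hx]
  ring

/-! ### The digamma integral -/

theorem digamma_add_one {x : ℝ} (hx : ∀ m : ℕ, x ≠ -(m : ℝ)) :
    digamma (x + 1) = digamma x + 1 / x := by
  have h0 : x ≠ 0 := by simpa using hx 0
  have hG : Real.Gamma x ≠ 0 := Real.Gamma_ne_zero hx
  have hd := (Real.differentiableAt_Gamma hx).hasDerivAt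
  have h1 : HasDerivAt (fun y => y * Real.Gamma y) (1 * Real.Gamma x + x * deriv Real.Gamma x) x :=
    (hasDerivAt_id x).mul hd
  have h2 : HasDerivAt (fun y => Real.Gamma (y + 1))
      (1 * Real.Gamma x + x * deriv Real.Gamma x) x := by
    refine h1.congr_of_eventuallyEq ?_
    filter_upwards [isOpen_ne.mem_nhds h0] with y hy
    exact Real.Gamma_add_one hy
  have h3 : deriv Real.Gamma (x + 1) = 1 * Real.Gamma x + x * deriv Real.Gamma x := by
    rw [← h2.deriv, deriv_comp_add_const]
  rw [digamma, digamma, h3, Real.Gamma_add_one h0]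
  field_simp
  ring

theorem monotoneOn_digamma : MonotoneOn digamma (Set.Ioi 0) := by
  have hne : ∀ x ∈ Set.Ioi (0 : ℝ), ∀ m : ℕ, x ≠ -(m : ℝ) := by
    intro x hx m h
    have : (0 : ℝ) ≤ m := m.cast_nonneg
    have : 0 < x := hx
    linarith
  have hd : ∀ x ∈ Set.Ioi (0 : ℝ), HasDerivAt (Real.log ∘ Real.Gamma) (digamma x) x := by
    intro x hx
    exact (Real.differentiableAt_Gamma (hne x hx)).hasDerivAt.log
      (Real.Gamma_ne_zero (hne x hx))
  refine (Real.convexOn_log_Gamma.monotoneOn_deriv fun x hx => (hd x hx).differentiableAt).congr ?_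
  intro x hx
  exact (hd x hx).deriv

theorem H_zero : H 0 = 0 := by simp [H, genHarmonic]

theorem genHarmonic_succ (r n : ℕ) :
    genHarmonic r (n + 1) = genHarmonic r n + 1 / ((n : ℝ) + 1) ^ r := by
  rw [genHarmonic, Finset.sum_Icc_succ_top (by omega), genHarmonic]
  push_cast
  rfl

theorem H_succ (n : ℕ) : H (n + 1) = H n + 1 / ((n : ℝ) + 1) := by
  rw [H, genHarmonic_succ, pow_one, H]

theorem digammaKernel_mono {s t x : ℝ} (hst : s ≤ t) (hx : x ∈ Set.Ioo (0 : ℝ) 1) :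
    digammaKernel s x ≤ digammaKernel t x := by
  have h : 0 < 1 - x := by linarith [hx.2]
  have := Real.rpow_le_rpow_of_exponent_ge hx.1 hx.2.le hst
  rw [digammaKernel, digammaKernel]
  gcongr

theorem integral_digammaKernel_mono {s t : ℝ} (hs : -1 < s) (hst : s ≤ t) :
    ∫ x in Set.Ioo (0 : ℝ) 1, digammaKernel s x ≤ ∫ x in Set.Ioo (0 : ℝ) 1, digammaKernel t x :=
  setIntegral_mono_on (integrableOn_digammaKernel hs)
    (integrableOn_digammaKernel (by linarith)) measurableSet_Ioo
    fun _ hx => digammaKernel_mono hst hx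

theorem integral_digammaKernel_add_one {s : ℝ} (hs : -1 < s) :
    ∫ x in Set.Ioo (0 : ℝ) 1, digammaKernel (s + 1) x =
      (∫ x in Set.Ioo (0 : ℝ) 1, digammaKernel s x) + 1 / (s + 1) := by
  have h := integral_digammaKernel_mul_eq_add_one_sub (s := s) (g := fun _ => 1)
    (by simpa using integrableOn_digammaKernel (by linarith))
    (by simpa using integrableOn_rpow hs)
  have h0 := integral_rpow_mul_one_sub_pow hs 0
  rw [betaMoment_zero (notNegInt_of_neg_one_lt hs)] at h0
  simp only [mul_one, pow_zero] at h h0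
  linarith

/-- Both sides satisfy the same recurrence under `s ↦ s + 1`, agree at natural numbers and are
monotone; so their difference is `1`-periodic and at most `1 / (n + 1)` beyond `n`, hence zero. -/
theorem integral_digammaKernel {s : ℝ} (hs : -1 < s) :
    ∫ x in Set.Ioo (0 : ℝ) 1, digammaKernel s x =
      Real.eulerMascheroniConstant + digamma (s + 1) := by
  set D : ℝ → ℝ := fun s => ∫ x in Set.Ioo (0 : ℝ) 1, digammaKernel s x with hD
  set E : ℝ → ℝ := fun s => Real.eulerMascheroniConstant + digamma (s + 1) with hE
  have hDs : ∀ s, -1 < s → D (s + 1) = D s + 1 / (s + 1) := fun s hs =>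
    integral_digammaKernel_add_one hs
  have hEs : ∀ s, -1 < s → E (s + 1) = E s + 1 / (s + 1) := by
    intro s hs
    have := digamma_add_one (x := s + 1) (by
      intro m
      simpa using (notNegInt_of_neg_one_lt hs).add_ne_neg_nat 0 m)
    simp only [hE]
    rw [this]
    ring
  have hD0 : D 0 = 0 := by simp [hD, digammaKernel]
  have hE0 : E 0 = 0 := by
    have := Real.deriv_Gamma_nat 0
    simp only [Nat.cast_zero, zero_add, Nat.factorial_zero, Nat.cast_one, one_mul,
      harmonic_zero, Rat.cast_zero, add_zero] at this
    simp [hE, digamma, this]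
  have hDn : ∀ n : ℕ, D n = H n := by
    intro n
    induction n with
    | zero => simpa [H_zero] using hD0
    | succ n ih =>
      have hn : (0 : ℝ) ≤ n := n.cast_nonneg
      push_cast
      rw [hDs n (by linarith), ih, H_succ]
  have hEn : ∀ n : ℕ, E n = H n := by
    intro n
    induction n with
    | zero => simpa [H_zero] using hE0
    | succ n ih =>
      have hn : (0 : ℝ) ≤ n := n.cast_nonneg
      push_cast
      rw [hEs n (by linarith), ih, H_succ]
  have hper : ∀ n : ℕ, D (s + n) - E (s + n) = D s - E s := by
    intro n
    induction n with
    | zero => simp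
    | succ n ih =>
      have hn : (0 : ℝ) ≤ n := n.cast_nonneg
      push_cast
      rw [← add_assoc, hDs _ (by linarith), hEs _ (by linarith), ← ih]
      ring
  have hDm : ∀ s t, -1 < s → s ≤ t → D s ≤ D t := fun s t => integral_digammaKernel_mono
  have hEm : ∀ s t, -1 < s → s ≤ t → E s ≤ E t := by
    intro s t hs hst
    have := monotoneOn_digamma (a := s + 1) (b := t + 1) (by simp; linarith) (by simp; linarith)
      (by linarith)
    simp only [hE]
    linarith
  have hbd : ∀ n : ℕ, |D s - E s| ≤ 1 / ((n : ℝ) + 1) := by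
    intro n
    -- `D` and `E` at `s + n + 1` both lie between `H m` and `H (m + 1)`
    set m := ⌊s + n + 1⌋₊ with hm
    have hn : (0 : ℝ) ≤ n := n.cast_nonneg
    have h0 : 0 ≤ s + n + 1 := by linarith
    have h1 : (m : ℝ) ≤ s + n + 1 := Nat.floor_le h0
    have h2 : s + n + 1 < m + 1 := Nat.lt_floor_add_one _
    have hnm : n ≤ m := by rw [hm]; exact Nat.le_floor (by linarith)
    have hnm' : (n : ℝ) ≤ m := by exact_mod_cast hnm
    have key := hper (n + 1)
    push_cast at key
    rw [← add_assoc] at key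
    have a1 := hDm m (s + n + 1) (by linarith) h1
    have a2 := hDm (s + n + 1) (m + 1) (by linarith) h2.le
    have b1 := hEm m (s + n + 1) (by linarith) h1
    have b2 := hEm (s + n + 1) (m + 1) (by linarith) h2.le
    have c1 := hDn (m + 1)
    have c2 := hEn (m + 1)
    rw [H_succ] at c1 c2
    push_cast at c1 c2
    rw [c1] at a2
    rw [c2] at b2
    rw [hDn] at a1
    rw [hEn] at b1
    have h3 : 1 / ((m : ℝ) + 1) ≤ 1 / ((n : ℝ) + 1) := by gcongr
    rw [← key, abs_le]
    constructor <;> linarith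
  have hlim := ge_of_tendsto' tendsto_one_div_add_atTop_nhds_zero_nat hbd
  have := abs_nonpos_iff.1 hlim
  change D s = E s
  linarith

theorem integral_digammaKernel_nat (n : ℕ) :
    ∫ x in Set.Ioo (0 : ℝ) 1, digammaKernel n x = H n := by
  induction n with
  | zero => simp [digammaKernel, H_zero]
  | succ n ih =>
    have hn : (0 : ℝ) ≤ n := n.cast_nonneg
    push_cast
    rw [integral_digammaKernel_add_one (by linarith), ih, H_succ]

/-! ### Termwise integration of power series in `1 - x` -/

theorem hasSum_integral_mul_powerSeries {w B : ℝ → ℝ} {b : ℕ → ℝ}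
    (hw : IntegrableOn w (Set.Ioo 0 1))
    (hB : ∀ x ∈ Set.Ioo (0 : ℝ) 1, HasSum (fun k => b k * (1 - x) ^ k) (B x))
    (hb : Summable fun k => |b k| * ∫ x in Set.Ioo (0 : ℝ) 1, |w x| * (1 - x) ^ k) :
    HasSum (fun k => b k * ∫ x in Set.Ioo (0 : ℝ) 1, w x * (1 - x) ^ k)
      (∫ x in Set.Ioo (0 : ℝ) 1, w x * B x) := by
  have hint : ∀ k : ℕ, IntegrableOn (fun x => w x * (1 - x) ^ k) (Set.Ioo 0 1) := by
    intro k
    have h := hw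
    rw [← integrableOn_Icc_iff_integrableOn_Ioo] at h ⊢
    exact h.mul_continuousOn (by fun_prop) isCompact_Icc
  have key := hasSum_integral_of_summable_integral_norm
    (μ := volume.restrict (Set.Ioo (0 : ℝ) 1)) (F := fun k x => b k * (w x * (1 - x) ^ k))
    (fun k => (hint k).const_mul (b k)) (by
      convert hb using 2 with k
      rw [← integral_const_mul]
      refine setIntegral_congr_fun (measurableSet_Ioo (a := (0 : ℝ))) fun x hx => ?_
      have h : 0 ≤ 1 - x := sub_nonneg.2 hx.2.le
      simp only [Real.norm_eq_abs, abs_mul, abs_pow, abs_of_nonneg h])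
  simp only [integral_const_mul] at key
  have heq : ∫ x in Set.Ioo (0 : ℝ) 1, ∑' k, b k * (w x * (1 - x) ^ k) =
      ∫ x in Set.Ioo (0 : ℝ) 1, w x * B x := by
    refine setIntegral_congr_fun measurableSet_Ioo fun x hx => ?_
    have h := ((hB x hx).mul_left (w x)).tsum_eq
    rw [← h]
    refine tsum_congr fun k => ?_
    ring
  rwa [heq] at key

theorem hasSum_integral_rpow_mul {s : ℝ} (hs : -1 < s) {B : ℝ → ℝ} {b : ℕ → ℝ}
    (hB : ∀ x ∈ Set.Ioo (0 : ℝ) 1, HasSum (fun k => b k * (1 - x) ^ k) (B x))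
    (hb : Summable fun k => |b k| * betaMoment k s) :
    HasSum (fun k => b k * betaMoment k s) (∫ x in Set.Ioo (0 : ℝ) 1, x ^ s * B x) := by
  have := hasSum_integral_mul_powerSeries (integrableOn_rpow hs) hB (by
    convert hb using 2 with k
    rw [← integral_rpow_mul_one_sub_pow hs]
    refine congrArg _ (setIntegral_congr_fun measurableSet_Ioo fun x hx => ?_)
    rw [abs_of_nonneg (Real.rpow_nonneg hx.1.le s)])
  simpa only [integral_rpow_mul_one_sub_pow hs] using this

theorem hasSum_integral_powerSeries {B : ℝ → ℝ} {b : ℕ → ℝ}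
    (hB : ∀ x ∈ Set.Ioo (0 : ℝ) 1, HasSum (fun k => b k * (1 - x) ^ k) (B x))
    (hb : Summable fun k : ℕ => |b k| / ((k : ℝ) + 1)) :
    HasSum (fun k : ℕ => b k / ((k : ℝ) + 1)) (∫ x in Set.Ioo (0 : ℝ) 1, B x) := by
  have := hasSum_integral_rpow_mul (s := 0) (by norm_num) hB (by
    simpa only [betaMoment_nat_zero, mul_one_div] using hb)
  simpa only [betaMoment_nat_zero, mul_one_div, Real.rpow_zero, one_mul] using this

/-- If `f x = c₀ + (1 - x) ∑ bₖ (1 - x) ^ k`, the constant term contributes the digamma integral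
and the denominator of the kernel cancels against the remaining factor `1 - x`. -/
theorem integral_digammaKernel_mul_powerSeries {s : ℝ} (hs : -1 < s) {f : ℝ → ℝ} {c₀ : ℝ}
    {b : ℕ → ℝ} (hf : ContinuousOn f (Set.Icc 0 1))
    (hB : ∀ x ∈ Set.Ioo (0 : ℝ) 1,
      HasSum (fun k => b k * (1 - x) ^ k) ((f x - c₀) / (1 - x)))
    (hb0 : Summable fun k : ℕ => |b k| / ((k : ℝ) + 1))
    (hbs : Summable fun k => |b k| * betaMoment k s) :
    ∫ x in Set.Ioo (0 : ℝ) 1, digammaKernel s x * f x =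
      c₀ * (Real.eulerMascheroniConstant + digamma (s + 1)) + ∑' k : ℕ, b k / ((k : ℝ) + 1) -
        ∑' k, b k * betaMoment k s := by
  have hmom : ∀ k : ℕ, IntegrableOn (fun x : ℝ => x ^ s * (1 - x) ^ k) (Set.Ioo 0 1) :=
    fun k => integrableOn_rpow_mul_continuousOn hs (by fun_prop)
  have hpow : ∀ k : ℕ, IntegrableOn (fun x : ℝ => (1 - x) ^ k) (Set.Ioo 0 1) := fun k => by
    simpa using integrableOn_rpow_mul_continuousOn (s := 0) (g := fun x => (1 - x) ^ k)
      (by norm_num) (by fun_prop)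
  have hpow_int : ∀ k : ℕ, ∫ x in Set.Ioo (0 : ℝ) 1, (1 - x) ^ k = 1 / ((k : ℝ) + 1) := fun k => by
    rw [← betaMoment_nat_zero, ← integral_rpow_mul_one_sub_pow (by norm_num)]
    simp only [Real.rpow_zero, one_mul]
  have hw : IntegrableOn (fun x : ℝ => 1 - x ^ s) (Set.Ioo 0 1) := by
    simpa [Pi.sub_def] using (hpow 0).sub (hmom 0)
  have hwint : ∀ k : ℕ, ∫ x in Set.Ioo (0 : ℝ) 1, (1 - x ^ s) * (1 - x) ^ k =
      1 / ((k : ℝ) + 1) - betaMoment k s := by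
    intro k
    rw [← hpow_int, ← integral_rpow_mul_one_sub_pow hs, ← integral_sub (hpow k) (hmom k)]
    refine setIntegral_congr_fun measurableSet_Ioo fun x _ => ?_
    ring
  have habs : ∀ k : ℕ, ∫ x in Set.Ioo (0 : ℝ) 1, |1 - x ^ s| * (1 - x) ^ k ≤
      1 / ((k : ℝ) + 1) + betaMoment k s := by
    intro k
    rw [← hpow_int, ← integral_rpow_mul_one_sub_pow hs, ← integral_add (hpow k) (hmom k)]
    refine setIntegral_mono_on ?_ ((hpow k).add (hmom k)) measurableSet_Ioo fun x hx => ?_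
    · have h : IntegrableOn (fun x : ℝ => |1 - x ^ s|) (Set.Ioo 0 1) := hw.abs
      rw [← integrableOn_Icc_iff_integrableOn_Ioo] at h ⊢
      exact h.mul_continuousOn (by fun_prop) isCompact_Icc
    · have h1 : 0 ≤ (1 - x) ^ k := pow_nonneg (by linarith [hx.2]) k
      have h2 : |1 - x ^ s| ≤ 1 + x ^ s := by
        have := Real.rpow_nonneg hx.1.le s
        rw [abs_le]; constructor <;> linarith
      calc |1 - x ^ s| * (1 - x) ^ k ≤ (1 + x ^ s) * (1 - x) ^ k := by gcongr
        _ = _ := by ring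
  have hsum : Summable fun k => |b k| * ∫ x in Set.Ioo (0 : ℝ) 1, |1 - x ^ s| * (1 - x) ^ k := by
    refine Summable.of_nonneg_of_le (fun k => ?_) (fun k => ?_) (hb0.add hbs)
    · refine mul_nonneg (abs_nonneg _) (setIntegral_nonneg measurableSet_Ioo fun x hx => ?_)
      exact mul_nonneg (abs_nonneg _) (pow_nonneg (by linarith [hx.2]) k)
    · calc _ ≤ |b k| * (1 / ((k : ℝ) + 1) + betaMoment k s) := by gcongr; exact habs k
        _ = _ := by ring
  have key := (hasSum_integral_mul_powerSeries hw hB hsum).tsum_eq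
  simp only [hwint] at key
  have hb0' : Summable fun k : ℕ => b k / ((k : ℝ) + 1) := by
    refine Summable.of_norm (hb0.congr fun k => ?_)
    rw [Real.norm_eq_abs, abs_div, abs_of_pos (by positivity : (0 : ℝ) < (k : ℝ) + 1)]
  have hbs' : Summable fun k => b k * betaMoment k s := by
    refine Summable.of_norm (hbs.congr fun k => ?_)
    rw [Real.norm_eq_abs, abs_mul, abs_of_nonneg (betaMoment_nonneg hs k)]
  have hsplit : ∫ x in Set.Ioo (0 : ℝ) 1, (1 - x ^ s) * ((f x - c₀) / (1 - x)) =
      (∫ x in Set.Ioo (0 : ℝ) 1, digammaKernel s x * f x) -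
        c₀ * ∫ x in Set.Ioo (0 : ℝ) 1, digammaKernel s x := by
    rw [← integral_const_mul, ← integral_sub (integrableOn_digammaKernel_mul hs hf)
      ((integrableOn_digammaKernel hs).const_mul c₀)]
    refine setIntegral_congr_fun measurableSet_Ioo fun x _ => ?_
    simp only [digammaKernel]
    ring
  rw [hsplit, integral_digammaKernel hs] at key
  have h3 : ∑' k : ℕ, b k * (1 / ((k : ℝ) + 1) - betaMoment k s) =
      ∑' k : ℕ, b k / ((k : ℝ) + 1) - ∑' k, b k * betaMoment k s := by
    rw [← hb0'.tsum_sub hbs']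
    refine tsum_congr fun k => ?_
    ring
  rw [h3] at key
  linarith

/-! ### Power series with geometrically decaying coefficients -/

/-- The sequence `c` is dominated by a convergent geometric series, so `∑ cₖ uᵏ` has radius of
convergence greater than `1`. -/
def GeomBounded (c : ℕ → ℝ) : Prop :=
  ∃ C r : ℝ, 0 ≤ C ∧ 0 ≤ r ∧ r < 1 ∧ ∀ k, |c k| ≤ C * r ^ k

theorem GeomBounded.summable_mul_pow {c : ℕ → ℝ} (hc : GeomBounded c) (m : ℕ) :
    Summable fun k : ℕ => |c k| * ((k : ℝ) + 1) ^ m := by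
  obtain ⟨C, r, hC, hr, hr1, h⟩ := hc
  have h1 : Summable fun k : ℕ => (k : ℝ) ^ m * r ^ k :=
    summable_pow_mul_geometric_of_norm_lt_one m (by rwa [Real.norm_eq_abs, abs_of_nonneg hr])
  have h2 : Summable fun k : ℕ => C * (2 ^ m * ((k : ℝ) ^ m * r ^ k) + r ^ k) :=
    ((h1.mul_left _).add (summable_geometric_of_lt_one hr hr1)).mul_left C
  refine Summable.of_nonneg_of_le (fun k => by positivity) (fun k => ?_) h2
  have h3 : ((k : ℝ) + 1) ^ m ≤ 2 ^ m * (k : ℝ) ^ m + 1 := by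
    rcases Nat.eq_zero_or_pos k with rfl | hk
    · have : (0 : ℝ) ≤ 2 ^ m * (0 : ℝ) ^ m := by positivity
      simp
    · have hk' : (1 : ℝ) ≤ k := by exact_mod_cast hk
      rw [← mul_pow]
      have : ((k : ℝ) + 1) ^ m ≤ (2 * k) ^ m := by gcongr; linarith
      linarith
  calc |c k| * ((k : ℝ) + 1) ^ m ≤ (C * r ^ k) * (2 ^ m * (k : ℝ) ^ m + 1) := by
        gcongr; exact h k
    _ = _ := by ring

theorem GeomBounded.succ {c : ℕ → ℝ} (hc : GeomBounded c) : GeomBounded fun k => c (k + 1) := by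
  obtain ⟨C, r, hC, hr, hr1, h⟩ := hc
  exact ⟨C * r, r, by positivity, hr, hr1, fun k => (h (k + 1)).trans_eq (by ring)⟩

theorem GeomBounded.summable_abs {c : ℕ → ℝ} (hc : GeomBounded c) : Summable fun k => |c k| := by
  simpa using hc.summable_mul_pow 0

theorem GeomBounded.summable_abs_mul_betaMoment {c : ℕ → ℝ} (hc : GeomBounded c) {s : ℝ}
    (hs : NotNegInt s) : Summable fun k => |c k| * |betaMoment k s| := by
  obtain ⟨C, m, hC, h⟩ := abs_betaMoment_le hs
  refine Summable.of_nonneg_of_le (fun k => by positivity) (fun k => ?_)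
    ((hc.summable_mul_pow m).mul_left C)
  calc |c k| * |betaMoment k s| ≤ |c k| * (C * ((k : ℝ) + 1) ^ m) := by gcongr; exact h k
    _ = _ := by ring

theorem GeomBounded.summable_mul_betaMoment {c : ℕ → ℝ} (hc : GeomBounded c) {s : ℝ}
    (hs : NotNegInt s) : Summable fun k => c k * betaMoment k s :=
  Summable.of_norm ((hc.summable_abs_mul_betaMoment hs).congr fun k => by
    rw [Real.norm_eq_abs, abs_mul])

theorem GeomBounded.summable_mul_pow_of_mem {c : ℕ → ℝ} (hc : GeomBounded c) {u : ℝ}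
    (hu : u ∈ Set.Icc (0 : ℝ) 1) : Summable fun k => c k * u ^ k := by
  refine Summable.of_norm_bounded hc.summable_abs fun k => ?_
  rw [Real.norm_eq_abs, abs_mul, abs_pow, abs_of_nonneg hu.1]
  exact mul_le_of_le_one_right (abs_nonneg _) (pow_le_one₀ hu.1 hu.2)

theorem GeomBounded.continuousOn_tsum {c : ℕ → ℝ} (hc : GeomBounded c) :
    ContinuousOn (fun u => ∑' k, c k * u ^ k) (Set.Icc 0 1) := by
  refine _root_.continuousOn_tsum (fun k => by fun_prop) hc.summable_abs fun k u hu => ?_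
  rw [Real.norm_eq_abs, abs_mul, abs_pow, abs_of_nonneg hu.1]
  exact mul_le_of_le_one_right (abs_nonneg _) (pow_le_one₀ hu.1 hu.2)

/-- The coefficients of `(∑ cₖ uᵏ) / (1 - u)`. -/
def partialSums (c : ℕ → ℝ) (k : ℕ) : ℝ := ∑ j ∈ Finset.range (k + 1), c j

theorem partialSums_zero (c : ℕ → ℝ) : partialSums c 0 = c 0 := by simp [partialSums]

theorem partialSums_succ (c : ℕ → ℝ) (k : ℕ) :
    partialSums c (k + 1) = partialSums c k + c (k + 1) := Finset.sum_range_succ _ _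

theorem GeomBounded.partialSums {c : ℕ → ℝ} (hc : GeomBounded c) (h0 : ∑' k, c k = 0) :
    GeomBounded (partialSums c) := by
  have hsum : Summable c := hc.summable_abs.of_abs
  obtain ⟨C, r, hC, hr, hr1, h⟩ := hc
  have h1 : 0 < 1 - r := by linarith
  refine ⟨C * r / (1 - r), r, by positivity, hr, hr1, fun k => ?_⟩
  have hsplit := hsum.sum_add_tsum_nat_add (k + 1)
  rw [h0] at hsplit
  have h2 : _root_.partialSums c k = -∑' i, c (i + (k + 1)) := by
    rw [_root_.partialSums]; linarith
  rw [h2, abs_neg]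
  have hg : HasSum (fun i : ℕ => C * r ^ (k + 1) * r ^ i) (C * r ^ (k + 1) * (1 - r)⁻¹) :=
    (hasSum_geometric_of_lt_one hr hr1).mul_left _
  have h3 := tsum_of_norm_bounded hg (f := fun i => c (i + (k + 1))) fun i => by
    rw [Real.norm_eq_abs]
    exact (h _).trans_eq (by ring)
  rw [Real.norm_eq_abs] at h3
  refine h3.trans_eq ?_
  field_simp
  ring

/-- Summation by parts for a weight `β` with differences `β'`. -/
theorem tsum_mul_eq_tsum_partialSums_mul {c β β' : ℕ → ℝ}
    (hβ : ∀ k, β k - β (k + 1) = β' k)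
    (h1 : Summable fun k => c k * β k) (h2 : Summable fun k => partialSums c k * β k) :
    ∑' k, c k * β k = ∑' k, partialSums c k * β' k := by
  have h3 : Summable fun k => partialSums c k * β (k + 1) := by
    have := ((summable_nat_add_iff 1).2 h2).sub ((summable_nat_add_iff 1).2 h1)
    refine this.congr fun k => ?_
    rw [partialSums_succ]; ring
  have h4 : ∑' k, c (k + 1) * β (k + 1) =
      ∑' k, partialSums c (k + 1) * β (k + 1) - ∑' k, partialSums c k * β (k + 1) := by
    rw [← ((summable_nat_add_iff 1).2 h2).tsum_sub h3]
    refine tsum_congr fun k => ?_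
    rw [partialSums_succ]; ring
  have h5 : ∑' k, partialSums c k * β' k =
      ∑' k, partialSums c k * β k - ∑' k, partialSums c k * β (k + 1) := by
    rw [← h2.tsum_sub h3]
    refine tsum_congr fun k => ?_
    rw [← hβ]; ring
  rw [h5, h1.tsum_eq_zero_add, h4, h2.tsum_eq_zero_add, partialSums_zero]
  ring

theorem GeomBounded.tsum_mul_betaMoment_eq {c : ℕ → ℝ} (hc : GeomBounded c) (h0 : ∑' k, c k = 0)
    {s : ℝ} (hs : NotNegInt s) :
    ∑' k, c k * betaMoment k s = ∑' k, _root_.partialSums c k * betaMoment k (s + 1) := by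
  refine tsum_mul_eq_tsum_partialSums_mul (fun k => ?_) (hc.summable_mul_betaMoment hs)
    ((hc.partialSums h0).summable_mul_betaMoment hs)
  rw [betaMoment_succ_left hs]
  ring

theorem GeomBounded.tsum_mul_pow_eq {c : ℕ → ℝ} (hc : GeomBounded c) (h0 : ∑' k, c k = 0)
    {u : ℝ} (hu : u ∈ Set.Icc (0 : ℝ) 1) :
    ∑' k, c k * u ^ k = (1 - u) * ∑' k, _root_.partialSums c k * u ^ k := by
  rw [tsum_mul_eq_tsum_partialSums_mul (β' := fun k => (1 - u) * u ^ k) (fun k => by ring)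
    (hc.summable_mul_pow_of_mem hu) ((hc.partialSums h0).summable_mul_pow_of_mem hu),
    ← tsum_mul_left]
  refine tsum_congr fun k => ?_
  ring

theorem GeomBounded.integral_rpow_mul {c : ℕ → ℝ} (hc : GeomBounded c) {s : ℝ} (hs : -1 < s) :
    ∫ x in Set.Ioo (0 : ℝ) 1, x ^ s * ∑' k, c k * (1 - x) ^ k = ∑' k, c k * betaMoment k s := by
  refine (hasSum_integral_rpow_mul hs (fun x hx => ?_) ?_).tsum_eq.symm
  · exact (hc.summable_mul_pow_of_mem ⟨by linarith [hx.2], by linarith [hx.1]⟩).hasSum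
  · refine (hc.summable_abs_mul_betaMoment (notNegInt_of_neg_one_lt hs)).congr fun k => ?_
    rw [abs_of_nonneg (betaMoment_nonneg hs k)]

/-- A zero of the power series at `u = 1` extends the moment formula by one unit in `s`. -/
theorem GeomBounded.integral_rpow_mul_of_zero {c : ℕ → ℝ} (hc : GeomBounded c)
    (h0 : ∑' k, c k = 0) {s : ℝ} (hn : NotNegInt s)
    (ih : ∫ x in Set.Ioo (0 : ℝ) 1, x ^ (s + 1) * ∑' k, _root_.partialSums c k * (1 - x) ^ k =
      ∑' k, _root_.partialSums c k * betaMoment k (s + 1)) :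
    ∫ x in Set.Ioo (0 : ℝ) 1, x ^ s * ∑' k, c k * (1 - x) ^ k = ∑' k, c k * betaMoment k s := by
  rw [hc.tsum_mul_betaMoment_eq h0 hn, ← ih]
  refine setIntegral_congr_fun measurableSet_Ioo fun x hx => ?_
  rw [hc.tsum_mul_pow_eq h0 ⟨by linarith [hx.2], by linarith [hx.1]⟩, Real.rpow_add_one hx.1.ne']
  ring

/-- The right-hand side of the integral formula for the digamma kernel and the power series with
coefficients `c`; it makes sense for every `s` that is not a negative integer. -/
noncomputable def digammaSeries (c : ℕ → ℝ) (s : ℝ) : ℝ :=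
  c 0 * (Real.eulerMascheroniConstant + digamma (s + 1)) +
    ∑' k : ℕ, c (k + 1) / ((k : ℝ) + 1) - ∑' k, c (k + 1) * betaMoment k s

theorem GeomBounded.digammaSeries_eq {c : ℕ → ℝ} (hc : GeomBounded c) {s : ℝ}
    (hs : NotNegInt s) :
    digammaSeries c s = digammaSeries c (s + 1) - ∑' k, c k * betaMoment k s := by
  have h1 := hc.succ.summable_mul_betaMoment hs
  have h2 := hc.succ.summable_mul_betaMoment hs.add_one
  have h3 : ∑' k, c (k + 1) * betaMoment (k + 1) s =
      ∑' k, c (k + 1) * betaMoment k s - ∑' k, c (k + 1) * betaMoment k (s + 1) := by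
    rw [← h1.tsum_sub h2]
    refine tsum_congr fun k => ?_
    rw [betaMoment_succ_left hs]; ring
  have h4 := digamma_add_one (x := s + 1) fun m => by simpa using hs.add_ne_neg_nat 0 m
  rw [(hc.summable_mul_betaMoment hs).tsum_eq_zero_add, h3, betaMoment_zero hs, digammaSeries,
    digammaSeries, h4]
  ring

theorem GeomBounded.integral_digammaKernel_mul {c : ℕ → ℝ} (hc : GeomBounded c) {s : ℝ}
    (hs : -1 < s) {f : ℝ → ℝ} (hf : ContinuousOn f (Set.Icc 0 1))
    (hfc : ∀ x ∈ Set.Icc (0 : ℝ) 1, f x = ∑' k, c k * (1 - x) ^ k) :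
    ∫ x in Set.Ioo (0 : ℝ) 1, digammaKernel s x * f x = digammaSeries c s := by
  refine integral_digammaKernel_mul_powerSeries hs hf (fun x hx => ?_) ?_ ?_
  · have hu : 1 - x ∈ Set.Icc (0 : ℝ) 1 := ⟨by linarith [hx.2], by linarith [hx.1]⟩
    have hne : 1 - x ≠ 0 := by linarith [hx.2]
    convert (hc.succ.summable_mul_pow_of_mem hu).hasSum using 1
    rw [hfc x (Set.Ioo_subset_Icc_self hx), (hc.summable_mul_pow_of_mem hu).tsum_eq_zero_add,
      pow_zero, mul_one, add_sub_cancel_left, div_eq_iff hne, ← tsum_mul_right]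
    refine tsum_congr fun k => ?_
    ring
  · refine Summable.of_nonneg_of_le (fun k => by positivity) (fun k => ?_) hc.succ.summable_abs
    exact div_le_self (abs_nonneg _) (by linarith [(k.cast_nonneg : (0 : ℝ) ≤ k)])
  · refine (hc.succ.summable_abs_mul_betaMoment (notNegInt_of_neg_one_lt hs)).congr fun k => ?_
    rw [abs_of_nonneg (betaMoment_nonneg hs k)]

/-- The formula for the digamma kernel descends from `s + 1` to `s` along with integrability. -/
theorem GeomBounded.integral_digammaKernel_mul_descend {c : ℕ → ℝ} (hc : GeomBounded c) {s : ℝ}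
    (hs : NotNegInt s) {f : ℝ → ℝ} (hf : ContinuousOn f (Set.Icc 0 1))
    (hint : IntegrableOn (fun x => x ^ s * f x) (Set.Ioo 0 1))
    (hmom : ∫ x in Set.Ioo (0 : ℝ) 1, x ^ s * f x = ∑' k, c k * betaMoment k s)
    (ih : ∫ x in Set.Ioo (0 : ℝ) 1, digammaKernel (s + 1) x * f x = digammaSeries c (s + 1)) :
    ∫ x in Set.Ioo (0 : ℝ) 1, digammaKernel s x * f x = digammaSeries c s := by
  have h1 : IntegrableOn (fun x => x ^ (s + 1) * f x) (Set.Ioo 0 1) := by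
    have h := hint
    rw [← integrableOn_Icc_iff_integrableOn_Ioo] at h
    have h2 := (h.mul_continuousOn continuousOn_id isCompact_Icc).mono_set Set.Ioo_subset_Icc_self
    refine h2.congr_fun (fun x hx => ?_) measurableSet_Ioo
    simp only [id]
    rw [Real.rpow_add_one hx.1.ne']
    ring
  rw [integral_digammaKernel_mul_eq_add_one_sub
    ((integrableOn_digammaKernel_mul_iff (s + 1) hf).2 h1) hint, ih, hmom,
    hc.digammaSeries_eq hs]

/-! ### The Taylor series of the squared logarithm -/

theorem sum_antidiagonal_one_div_mul (n : ℕ) :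
    ∑ p ∈ Finset.HasAntidiagonal.antidiagonal n, (1 / ((p.1 : ℝ) + 1)) * (1 / ((p.2 : ℝ) + 1)) =
      2 * H (n + 1) / ((n : ℝ) + 2) := by
  have hH : ∀ n : ℕ, H n = ∑ i ∈ Finset.range n, 1 / ((i : ℝ) + 1) := by
    intro n
    induction n with
    | zero => simp [H_zero]
    | succ n ih => rw [Finset.sum_range_succ, H_succ, ih]
  have h1 : ∑ p ∈ Finset.HasAntidiagonal.antidiagonal n,
      (1 / ((p.1 : ℝ) + 1)) * (1 / ((p.2 : ℝ) + 1)) =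
      ∑ p ∈ Finset.HasAntidiagonal.antidiagonal n, (1 / ((n : ℝ) + 2)) *
        (1 / ((p.1 : ℝ) + 1) + 1 / ((p.2 : ℝ) + 1)) := by
    refine Finset.sum_congr rfl fun p hp => ?_
    have h : (n : ℝ) = p.1 + p.2 := by
      exact_mod_cast (Finset.HasAntidiagonal.mem_antidiagonal.1 hp).symm
    rw [h]
    field_simp
    ring
  have h2 : ∑ p ∈ Finset.HasAntidiagonal.antidiagonal n, 1 / ((p.1 : ℝ) + 1) = H (n + 1) := by
    rw [hH, Finset.Nat.sum_antidiagonal_eq_sum_range_succ_mk]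
  have h3 : ∑ p ∈ Finset.HasAntidiagonal.antidiagonal n, 1 / ((p.2 : ℝ) + 1) = H (n + 1) := by
    rw [← h2, ← Finset.Nat.sum_antidiagonal_swap]
    rfl
  rw [h1, ← Finset.mul_sum, Finset.sum_add_distrib, h2, h3]
  ring

theorem hasSum_log_sq {z : ℝ} (hz : |z| < 1) :
    HasSum (fun k : ℕ => 2 * H k / ((k : ℝ) + 1) * z ^ (k + 1)) (Real.log (1 - z) ^ 2) := by
  have h1 := Real.hasSum_pow_div_log_of_abs_lt_one hz
  have h2 : Summable fun k : ℕ => ‖z ^ (k + 1) / ((k : ℝ) + 1)‖ := by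
    refine Summable.of_nonneg_of_le (fun k => norm_nonneg _) (fun k => ?_)
      (summable_geometric_of_lt_one (abs_nonneg z) hz)
    rw [Real.norm_eq_abs, abs_div, abs_pow, abs_of_pos (by positivity : (0 : ℝ) < (k : ℝ) + 1)]
    refine (div_le_self (by positivity) (by linarith [(k.cast_nonneg : (0 : ℝ) ≤ k)])).trans ?_
    exact pow_le_pow_of_le_one (abs_nonneg z) hz.le (Nat.le_succ k)
  have h3 := tsum_mul_tsum_eq_tsum_sum_antidiagonal_of_summable_norm h2 h2
  have h4 := (summable_norm_sum_mul_antidiagonal_of_summable_norm h2 h2).of_norm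
  have h5 : ∀ n : ℕ, ∑ p ∈ Finset.HasAntidiagonal.antidiagonal n,
      z ^ (p.1 + 1) / ((p.1 : ℝ) + 1) * (z ^ (p.2 + 1) / ((p.2 : ℝ) + 1)) =
      2 * H (n + 1) / (((n + 1 : ℕ) : ℝ) + 1) * z ^ (n + 1 + 1) := by
    intro n
    have : 2 * H (n + 1) / (((n + 1 : ℕ) : ℝ) + 1) = 2 * H (n + 1) / ((n : ℝ) + 2) := by
      push_cast; ring
    rw [this, ← sum_antidiagonal_one_div_mul, Finset.sum_mul]
    refine Finset.sum_congr rfl fun p hp => ?_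
    have h : n = p.1 + p.2 := (Finset.HasAntidiagonal.mem_antidiagonal.1 hp).symm
    rw [h]
    ring
  simp only [h5] at h3 h4
  rw [h1.tsum_eq] at h3
  have h6 := h4.hasSum
  rw [← h3] at h6
  rw [← hasSum_nat_add_iff' 1]
  simpa [H_zero, sq] using h6

theorem H_nonneg (n : ℕ) : 0 ≤ H n := by
  rw [H, genHarmonic]
  positivity

theorem H_le (n : ℕ) : H n ≤ n := by
  induction n with
  | zero => simp [H_zero]
  | succ n ih =>
    rw [H_succ]
    have : 1 / ((n : ℝ) + 1) ≤ 1 :=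
      div_le_one_of_le₀ (by linarith [(n.cast_nonneg : (0 : ℝ) ≤ n)]) (by positivity)
    push_cast
    linarith

/-- Any bound of order `k ^ θ` with `θ < 1` makes `∑ H k / (k + 1) ^ 2` converge. -/
theorem H_le_two_mul_sqrt (n : ℕ) : H n ≤ 2 * √(n : ℝ) := by
  induction n with
  | zero => simp [H_zero]
  | succ n ih =>
    rw [H_succ]
    push_cast
    have hn : (0 : ℝ) ≤ n := n.cast_nonneg
    have h1 : √(n : ℝ) ^ 2 = n := Real.sq_sqrt hn
    have h2 : √((n : ℝ) + 1) ^ 2 = n + 1 := Real.sq_sqrt (by positivity)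
    have h3 : 1 ≤ √((n : ℝ) + 1) := by rw [Real.one_le_sqrt]; linarith
    have h4 : √(n : ℝ) ≤ √((n : ℝ) + 1) := Real.sqrt_le_sqrt (by linarith)
    have h5 : 1 / ((n : ℝ) + 1) ≤ 1 / √((n : ℝ) + 1) := by
      gcongr
      nlinarith
    have h6 : 1 / √((n : ℝ) + 1) ≤ 2 * (√((n : ℝ) + 1) - √(n : ℝ)) := by
      rw [div_le_iff₀ (by linarith)]
      nlinarith [Real.sqrt_nonneg (n : ℝ)]
    linarith

theorem summable_H_div_sq : Summable fun k : ℕ => H k / ((k : ℝ) + 1) ^ 2 := by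
  have h : Summable fun k : ℕ => 2 * (1 / ((k + 1 : ℕ) : ℝ) ^ (3 / 2 : ℝ)) :=
    ((summable_nat_add_iff 1).2
      (Real.summable_one_div_nat_rpow.2 (by norm_num : (1 : ℝ) < 3 / 2))).mul_left 2
  refine Summable.of_nonneg_of_le (fun k => div_nonneg (H_nonneg k) (by positivity))
    (fun k => ?_) h
  have hk : (0 : ℝ) < (k : ℝ) + 1 := by positivity
  have h1 : H k ≤ 2 * √((k : ℝ) + 1) :=
    (H_le_two_mul_sqrt k).trans (by gcongr; linarith)
  have h2 : ((k : ℝ) + 1) ^ 2 = √((k : ℝ) + 1) * ((k : ℝ) + 1) ^ (3 / 2 : ℝ) := by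
    rw [Real.sqrt_eq_rpow, ← Real.rpow_add hk, ← Real.rpow_natCast]
    norm_num
  have h3 : 0 < √((k : ℝ) + 1) := Real.sqrt_pos.2 hk
  have h4 : 0 < ((k : ℝ) + 1) ^ (3 / 2 : ℝ) := Real.rpow_pos_of_pos hk _
  push_cast
  rw [h2, div_le_iff₀ (by positivity)]
  refine h1.trans_eq ?_
  field_simp

/-! ### Polylogarithms -/

theorem hasDerivAt_polylog (n : ℕ) {x : ℝ} (hx : x ∈ Set.Ioo (0 : ℝ) 1) :
    HasDerivAt (polylog (n + 1)) (polylog n x / x) x := by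
  obtain ⟨r, hxr, hr1⟩ := exists_between hx.2
  have hr0 : 0 < r := hx.1.trans hxr
  have hterm : ∀ (k : ℕ), ∀ y ∈ Set.Ioo (0 : ℝ) r,
      HasDerivAt (fun y : ℝ => y ^ (k + 1) / ((k : ℝ) + 1) ^ (n + 1)) (y ^ k / ((k : ℝ) + 1) ^ n)
        y := by
    intro k y _
    have h := (hasDerivAt_pow (k + 1) y).div_const (((k : ℝ) + 1) ^ (n + 1))
    refine h.congr_deriv ?_
    push_cast
    field_simp
    ring
  have hbound : ∀ (k : ℕ), ∀ y ∈ Set.Ioo (0 : ℝ) r, ‖y ^ k / ((k : ℝ) + 1) ^ n‖ ≤ r ^ k := by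
    intro k y hy
    have hk : (1 : ℝ) ≤ ((k : ℝ) + 1) ^ n :=
      one_le_pow₀ (by linarith [(k.cast_nonneg : (0 : ℝ) ≤ k)])
    rw [Real.norm_eq_abs, abs_of_nonneg (div_nonneg (pow_nonneg hy.1.le k) (by positivity))]
    exact (div_le_self (pow_nonneg hy.1.le k) hk).trans (pow_le_pow_left₀ hy.1.le hy.2.le k)
  have hsum0 : Summable fun k : ℕ => x ^ (k + 1) / ((k : ℝ) + 1) ^ (n + 1) := by
    refine Summable.of_nonneg_of_le (fun k => div_nonneg (pow_nonneg hx.1.le _) (by positivity))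
      (fun k => ?_) (summable_geometric_of_lt_one hx.1.le hx.2)
    have hk : (1 : ℝ) ≤ ((k : ℝ) + 1) ^ (n + 1) :=
      one_le_pow₀ (by linarith [(k.cast_nonneg : (0 : ℝ) ≤ k)])
    exact (div_le_self (pow_nonneg hx.1.le _) hk).trans
      (pow_le_pow_of_le_one hx.1.le hx.2.le (Nat.le_succ k))
  have h := hasDerivAt_tsum_of_isPreconnected (summable_geometric_of_lt_one hr0.le hr1)
    isOpen_Ioo isPreconnected_Ioo hterm hbound ⟨hx.1, hxr⟩ hsum0 ⟨hx.1, hxr⟩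
  refine h.congr_deriv ?_
  rw [polylog, ← tsum_div_const]
  refine tsum_congr fun k => ?_
  have := hx.1.ne'
  field_simp
  ring

theorem polylog_one {x : ℝ} (hx : |x| < 1) : polylog 1 x = -Real.log (1 - x) := by
  rw [← (Real.hasSum_pow_div_log_of_abs_lt_one hx).tsum_eq, polylog]
  simp only [pow_one]

theorem continuousOn_polylog {n : ℕ} (hn : 2 ≤ n) :
    ContinuousOn (polylog n) (Set.Icc 0 1) := by
  have h : Summable fun k : ℕ => 1 / ((k : ℝ) + 1) ^ n := by
    have := (summable_nat_add_iff 1).2 (Real.summable_one_div_nat_pow.2 (by omega : 1 < n))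
    simpa using this
  refine _root_.continuousOn_tsum (fun k => by fun_prop) h fun k x hx => ?_
  rw [Real.norm_eq_abs, abs_of_nonneg (div_nonneg (pow_nonneg hx.1 _) (by positivity))]
  gcongr
  exact pow_le_one₀ hx.1 hx.2

theorem polylog_three_one : polylog 3 1 = zetaThree := by
  have h := zeta_nat_eq_tsum_of_gt_one (k := 3) (by norm_num)
  have h2 : Summable fun n : ℕ => 1 / (n : ℝ) ^ 3 := Real.summable_one_div_nat_pow.2 (by norm_num)
  have h3 : riemannZeta 3 = ((∑' n : ℕ, 1 / (n : ℝ) ^ 3 : ℝ) : ℂ) := by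
    push_cast at h ⊢
    exact h
  rw [zetaThree, h3, Complex.ofReal_re, h2.tsum_eq_zero_add, polylog]
  simp

/-! ### The integrals of `log² (1 ± t) / t` -/

/-- The convention `log 0 = 0` makes the value at `0` agree with the limit, so the primitives below
are continuous up to the endpoint. -/
theorem continuousAt_log_mul_log_one_add_sq :
    ContinuousAt (fun t : ℝ => Real.log t * Real.log (1 + t) ^ 2) 0 := by
  have hd : HasDerivAt (fun t : ℝ => Real.log (1 + t)) (1 / (1 + 0)) 0 :=
    ((hasDerivAt_id (0 : ℝ)).const_add 1).log (by norm_num)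
  have h1 : (fun t : ℝ => Real.log (1 + t)) =O[nhds 0] fun t => t := by
    simpa using hd.isBigO_sub
  have h2 : (fun t : ℝ => Real.log t * Real.log (1 + t) ^ 2) =O[nhds 0]
      fun t => Real.log t * t ^ 2 :=
    (Asymptotics.isBigO_refl _ _).mul (h1.pow 2)
  have h3 : Filter.Tendsto (fun t : ℝ => Real.log t * t ^ 2) (nhds 0) (nhds 0) := by
    have h : Continuous fun t : ℝ => (t * Real.log t) * t :=
      Real.continuous_mul_log.mul continuous_id
    have h4 := h.tendsto 0
    simp only [mul_zero] at h4
    refine h4.congr fun t => ?_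
    ring
  have h5 := h2.trans_tendsto h3
  simpa [ContinuousAt] using h5

theorem continuousAt_log_mul_log_one_sub_sq :
    ContinuousAt (fun t : ℝ => Real.log t * Real.log (1 - t) ^ 2) 0 := by
  have h : ContinuousAt (fun t : ℝ => Real.log (-t) * Real.log (1 + -t) ^ 2) 0 :=
    ContinuousAt.comp (f := fun t : ℝ => -t)
      (g := fun t : ℝ => Real.log t * Real.log (1 + t) ^ 2)
      (by simpa using continuousAt_log_mul_log_one_add_sq) continuousAt_neg
  simpa only [Real.log_neg_eq_log, ← sub_eq_add_neg] using h

/-- The fundamental theorem of calculus for a nonnegative derivative. -/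
theorem integral_eq_sub_of_hasDerivAt_of_nonneg {a b : ℝ} (hab : a ≤ b) {f f' : ℝ → ℝ}
    (hf : ContinuousOn f (Set.Icc a b)) (hd : ∀ x ∈ Set.Ioo a b, HasDerivAt f (f' x) x)
    (h0 : ∀ x ∈ Set.Ioo a b, 0 ≤ f' x) : ∫ x in a..b, f' x = f b - f a :=
  intervalIntegral.integral_eq_sub_of_hasDerivAt_of_le hab hf hd
    ((intervalIntegrable_iff_integrableOn_Ioc_of_le hab).2
      (intervalIntegral.integrableOn_deriv_of_nonneg hf hd h0))

theorem integral_log_one_sub_sq_div {y : ℝ} (hy : y ∈ Set.Ioo (0 : ℝ) 1) :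
    ∫ t in (0 : ℝ)..y, Real.log (1 - t) ^ 2 / t =
      Real.log y * Real.log (1 - y) ^ 2 + 2 * Real.log (1 - y) * polylog 2 (1 - y)
        - 2 * polylog 3 (1 - y) + 2 * zetaThree := by
  have hmaps : Set.MapsTo (fun t : ℝ => 1 - t) (Set.Icc 0 y) (Set.Icc 0 1) := fun t ht =>
    ⟨by linarith [ht.2, hy.2], by linarith [ht.1]⟩
  have hsub : ContinuousOn (fun t : ℝ => 1 - t) (Set.Icc 0 y) := by fun_prop
  have hlog : ContinuousOn (fun t : ℝ => Real.log (1 - t)) (Set.Icc 0 y) :=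
    hsub.log fun t ht => by linarith [ht.2, hy.2]
  have hc : ContinuousOn (fun t : ℝ => Real.log t * Real.log (1 - t) ^ 2) (Set.Icc 0 y) := by
    intro t ht
    rcases ht.1.eq_or_lt with rfl | h
    · exact continuousAt_log_mul_log_one_sub_sq.continuousWithinAt
    · exact (Real.continuousAt_log h.ne').continuousWithinAt.mul ((hlog t ht).pow 2)
  rw [integral_eq_sub_of_hasDerivAt_of_nonneg hy.1.le
    (f := fun t => Real.log t * Real.log (1 - t) ^ 2 + 2 * Real.log (1 - t) * polylog 2 (1 - t)
        - 2 * polylog 3 (1 - t))]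
  · simp only [sub_zero, Real.log_one, polylog_three_one]
    ring
  · refine (hc.add ((continuousOn_const.mul hlog).mul ?_)).sub (continuousOn_const.mul ?_)
    · exact (continuousOn_polylog le_rfl).comp hsub hmaps
    · exact (continuousOn_polylog (by norm_num)).comp hsub hmaps
  · intro t ht
    have ht0 : t ≠ 0 := ht.1.ne'
    have ht1 : 1 - t ≠ 0 := by linarith [ht.2, hy.2]
    have hmem : 1 - t ∈ Set.Ioo (0 : ℝ) 1 := ⟨by linarith [ht.2, hy.2], by linarith [ht.1]⟩
    have hs : HasDerivAt (fun t : ℝ => 1 - t) (-1) t := by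
      simpa using (hasDerivAt_id t).const_sub 1
    have hl := hs.log ht1
    have h2 : HasDerivAt (fun t : ℝ => polylog 2 (1 - t)) (polylog 1 (1 - t) / (1 - t) * -1) t :=
      (hasDerivAt_polylog 1 hmem).comp t hs
    have h3 : HasDerivAt (fun t : ℝ => polylog 3 (1 - t)) (polylog 2 (1 - t) / (1 - t) * -1) t :=
      (hasDerivAt_polylog 2 hmem).comp t hs
    rw [polylog_one (by rw [abs_of_pos hmem.1]; exact hmem.2), sub_sub_cancel] at h2
    have h := (((Real.hasDerivAt_log ht0).mul (hl.pow 2)).add ((hl.const_mul 2).mul h2)).sub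
      (h3.const_mul 2)
    refine h.congr_deriv ?_
    simp only [Pi.pow_apply, Nat.cast_ofNat, Nat.add_one_sub_one, pow_one]
    field_simp
    ring
  · intro t ht
    exact div_nonneg (sq_nonneg _) ht.1.le

theorem integral_log_one_add_sq_div {w : ℝ} (hw : 0 < w) :
    ∫ t in (0 : ℝ)..w, Real.log (1 + t) ^ 2 / t =
      Real.log w * Real.log (1 + w) ^ 2 - 2 / 3 * Real.log (1 + w) ^ 3
        - 2 * Real.log (1 + w) * polylog 2 (1 / (1 + w)) - 2 * polylog 3 (1 / (1 + w))
        + 2 * zetaThree := by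
  have hmaps : Set.MapsTo (fun t : ℝ => 1 / (1 + t)) (Set.Icc 0 w) (Set.Icc 0 1) := by
    intro t ht
    have : 0 ≤ t := ht.1
    exact ⟨by positivity, div_le_one_of_le₀ (by linarith) (by linarith)⟩
  have hadd : ContinuousOn (fun t : ℝ => 1 + t) (Set.Icc 0 w) := by fun_prop
  have hne : ∀ t ∈ Set.Icc 0 w, 1 + t ≠ 0 := fun t ht => by linarith [ht.1]
  have hinv : ContinuousOn (fun t : ℝ => 1 / (1 + t)) (Set.Icc 0 w) :=
    continuousOn_const.div hadd hne
  have hlog : ContinuousOn (fun t : ℝ => Real.log (1 + t)) (Set.Icc 0 w) := hadd.log hne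
  have hc : ContinuousOn (fun t : ℝ => Real.log t * Real.log (1 + t) ^ 2) (Set.Icc 0 w) := by
    intro t ht
    rcases ht.1.eq_or_lt with rfl | h
    · exact continuousAt_log_mul_log_one_add_sq.continuousWithinAt
    · exact (Real.continuousAt_log h.ne').continuousWithinAt.mul ((hlog t ht).pow 2)
  rw [integral_eq_sub_of_hasDerivAt_of_nonneg hw.le
    (f := fun t => Real.log t * Real.log (1 + t) ^ 2 - 2 / 3 * Real.log (1 + t) ^ 3
        - 2 * Real.log (1 + t) * polylog 2 (1 / (1 + t)) - 2 * polylog 3 (1 / (1 + t)))]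
  · simp only [add_zero, Real.log_one, div_one, polylog_three_one]
    ring
  · refine ((hc.sub (continuousOn_const.mul (hlog.pow 3))).sub
      ((continuousOn_const.mul hlog).mul ?_)).sub (continuousOn_const.mul ?_)
    · exact (continuousOn_polylog le_rfl).comp hinv hmaps
    · exact (continuousOn_polylog (by norm_num)).comp hinv hmaps
  · intro t ht
    have ht0 : t ≠ 0 := ht.1.ne'
    have htp : 0 < t := ht.1
    have ht1 : 1 + t ≠ 0 := by positivity
    have hmem : 1 / (1 + t) ∈ Set.Ioo (0 : ℝ) 1 :=
      ⟨by positivity, by rw [div_lt_one (by positivity)]; linarith⟩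
    have hs : HasDerivAt (fun t : ℝ => 1 + t) 1 t := (hasDerivAt_id t).const_add 1
    have hi : HasDerivAt (fun t : ℝ => 1 / (1 + t)) (-1 / (1 + t) ^ 2) t := by
      simpa [one_div, Pi.inv_def] using hs.inv ht1
    have hl := hs.log ht1
    have h2 : HasDerivAt (fun t : ℝ => polylog 2 (1 / (1 + t)))
        (polylog 1 (1 / (1 + t)) / (1 / (1 + t)) * (-1 / (1 + t) ^ 2)) t :=
      HasDerivAt.comp (h₂ := polylog 2) (h := fun t => 1 / (1 + t)) t (hasDerivAt_polylog 1 hmem) hi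
    have h3 : HasDerivAt (fun t : ℝ => polylog 3 (1 / (1 + t)))
        (polylog 2 (1 / (1 + t)) / (1 / (1 + t)) * (-1 / (1 + t) ^ 2)) t :=
      HasDerivAt.comp (h₂ := polylog 3) (h := fun t => 1 / (1 + t)) t (hasDerivAt_polylog 2 hmem) hi
    have hlog1 : Real.log (1 - 1 / (1 + t)) = Real.log t - Real.log (1 + t) := by
      rw [← Real.log_div ht0 ht1]
      congr 1
      field_simp
      ring
    rw [polylog_one (by rw [abs_of_pos hmem.1]; exact hmem.2), hlog1] at h2
    have h := ((((Real.hasDerivAt_log ht0).mul (hl.pow 2)).sub ((hl.pow 3).const_mul (2 / 3))).sub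
      ((hl.const_mul 2).mul h2)).sub (h3.const_mul 2)
    refine h.congr_deriv ?_
    simp only [Pi.pow_apply, Nat.cast_ofNat, Nat.add_one_sub_one, pow_one]
    field_simp
    ring
  · intro t ht
    exact div_nonneg (sq_nonneg _) ht.1.le

/-- The substitution `t = y (1 - x)`. -/
theorem integral_comp_mul_one_sub_div (h : ℝ → ℝ) {y : ℝ} (hy : y ≠ 0) :
    ∫ x in Set.Ioo (0 : ℝ) 1, h (y * (1 - x)) / (1 - x) = ∫ t in (0 : ℝ)..y, h t / t := by
  have key := intervalIntegral.integral_comp_sub_mul (a := 0) (b := 1) (fun t => h t / t) hy y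
  rw [mul_one, mul_zero, sub_self, sub_zero, smul_eq_mul] at key
  have key2 : ∫ t in (0 : ℝ)..y, h t / t =
      y * ∫ x in (0 : ℝ)..1, h (y - y * x) / (y - y * x) := by
    rw [key]; field_simp
  rw [key2, intervalIntegral.integral_of_le zero_le_one, integral_Ioc_eq_integral_Ioo,
    ← integral_const_mul]
  refine setIntegral_congr_fun measurableSet_Ioo fun x hx => ?_
  have hne : 1 - x ≠ 0 := by linarith [hx.2]
  have h1 : y - y * x = y * (1 - x) := by ring
  simp only [h1]
  field_simp

/-! ### The weight `log² (x + a)` -/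

/-- The Taylor coefficients of `log² (x + a)` in powers of `1 - x`. -/
noncomputable def logSqTaylor (a : ℝ) : ℕ → ℝ
  | 0 => Real.log (a + 1) ^ 2
  | k + 1 => (2 * H k - 2 * Real.log (a + 1)) / ((k : ℝ) + 1) * (1 / (a + 1)) ^ (k + 1)

theorem one_div_add_one_mem {a : ℝ} (ha : 0 < a) : 1 / (a + 1) ∈ Set.Ioo (0 : ℝ) 1 :=
  ⟨by positivity, by rw [div_lt_one (by positivity)]; linarith⟩

theorem geomBounded_pow_div {a : ℝ} (ha : 0 < a) :
    GeomBounded fun k => (1 / (a + 1)) ^ (k + 1) / ((k : ℝ) + 1) := by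
  have hy := one_div_add_one_mem ha
  refine ⟨1, 1 / (a + 1), zero_le_one, hy.1.le, hy.2, fun k => ?_⟩
  have h0 := hy.1
  rw [abs_of_nonneg (by positivity), one_mul]
  refine (div_le_self (by positivity) (by linarith [(k.cast_nonneg : (0 : ℝ) ≤ k)])).trans ?_
  exact pow_le_pow_of_le_one hy.1.le hy.2.le (Nat.le_succ k)

theorem geomBounded_H_mul_pow_div {a : ℝ} (ha : 0 < a) :
    GeomBounded fun k => H k * (1 / (a + 1)) ^ (k + 1) / ((k : ℝ) + 1) := by
  have hy := one_div_add_one_mem ha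
  refine ⟨1, 1 / (a + 1), zero_le_one, hy.1.le, hy.2, fun k => ?_⟩
  have h0 := hy.1
  have hH := H_nonneg k
  have hk : H k ≤ (k : ℝ) + 1 := (H_le k).trans (by linarith)
  rw [abs_of_nonneg (by positivity), one_mul, div_le_iff₀ (by positivity), mul_comm]
  refine mul_le_mul ?_ hk hH (by positivity)
  exact pow_le_pow_of_le_one hy.1.le hy.2.le (Nat.le_succ k)

theorem logSqTaylor_succ (a : ℝ) (k : ℕ) :
    logSqTaylor a (k + 1) = 2 * (H k * (1 / (a + 1)) ^ (k + 1) / ((k : ℝ) + 1)) -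
      2 * Real.log (a + 1) * ((1 / (a + 1)) ^ (k + 1) / ((k : ℝ) + 1)) := by
  rw [logSqTaylor]; ring

theorem GeomBounded.of_succ {c : ℕ → ℝ} (hc : GeomBounded fun k => c (k + 1)) :
    GeomBounded c := by
  obtain ⟨C, r, hC, hr, hr1, h⟩ := hc
  -- enlarging the ratio makes it nonzero, so that the index can be shifted
  have hr' : 0 < (r + 1) / 2 := by linarith
  refine ⟨|c 0| + C / ((r + 1) / 2), (r + 1) / 2, by positivity, hr'.le, by linarith, fun k => ?_⟩
  cases k with
  | zero =>
    rw [pow_zero, mul_one]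
    have : 0 ≤ C / ((r + 1) / 2) := by positivity
    linarith
  | succ k =>
    have h1 : C * r ^ k ≤ C * ((r + 1) / 2) ^ k := by gcongr; linarith
    have h2 : C * ((r + 1) / 2) ^ k = C / ((r + 1) / 2) * ((r + 1) / 2) ^ (k + 1) := by
      rw [pow_succ]; field_simp
    have h3 : 0 ≤ |c 0| * ((r + 1) / 2) ^ (k + 1) := by positivity
    rw [add_mul]
    linarith [h k]

theorem GeomBounded.const_mul {c : ℕ → ℝ} (hc : GeomBounded c) (t : ℝ) :
    GeomBounded fun k => t * c k := by
  obtain ⟨C, r, hC, hr, hr1, h⟩ := hc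
  refine ⟨|t| * C, r, by positivity, hr, hr1, fun k => ?_⟩
  rw [abs_mul, mul_assoc]
  gcongr
  exact h k

theorem GeomBounded.sub {c d : ℕ → ℝ} (hc : GeomBounded c) (hd : GeomBounded d) :
    GeomBounded fun k => c k - d k := by
  obtain ⟨C, r, hC, hr, hr1, h⟩ := hc
  obtain ⟨D, q, hD, hq, hq1, h'⟩ := hd
  refine ⟨C + D, max r q, by positivity, le_max_of_le_left hr, max_lt hr1 hq1, fun k => ?_⟩
  calc |c k - d k| ≤ |c k| + |d k| := abs_sub _ _
    _ ≤ C * r ^ k + D * q ^ k := add_le_add (h k) (h' k)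
    _ ≤ C * (max r q) ^ k + D * (max r q) ^ k := by
        gcongr
        · exact le_max_left _ _
        · exact le_max_right _ _
    _ = _ := by ring

theorem geomBounded_logSqTaylor {a : ℝ} (ha : 0 < a) : GeomBounded (logSqTaylor a) := by
  refine GeomBounded.of_succ ?_
  simp only [logSqTaylor_succ]
  exact ((geomBounded_H_mul_pow_div ha).const_mul 2).sub
    ((geomBounded_pow_div ha).const_mul (2 * Real.log (a + 1)))

theorem log_add_eq {a x : ℝ} (ha : 0 < a) (hx : x ∈ Set.Icc (0 : ℝ) 1) :
    Real.log (x + a) = Real.log (a + 1) + Real.log (1 - 1 / (a + 1) * (1 - x)) := by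
  have h1 : a + 1 ≠ 0 := by positivity
  have h2 : x + a ≠ 0 := by linarith [hx.1]
  have h3 : x + a = (a + 1) * (1 - 1 / (a + 1) * (1 - x)) := by field_simp; ring
  rw [← Real.log_mul h1, ← h3]
  rintro h4
  rw [h4, mul_zero] at h3
  exact h2 h3

theorem hasSum_logSqTaylor {a x : ℝ} (ha : 0 < a) (hx : x ∈ Set.Icc (0 : ℝ) 1) :
    HasSum (fun k => logSqTaylor a k * (1 - x) ^ k) (Real.log (x + a) ^ 2) := by
  have hy := one_div_add_one_mem ha
  have hz : |1 / (a + 1) * (1 - x)| < 1 := by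
    have h1 : 0 ≤ 1 - x := by linarith [hx.2]
    have h0 := hy.1
    rw [abs_of_nonneg (by positivity)]
    nlinarith [hy.2, hx.1]
  have h1 := (Real.hasSum_pow_div_log_of_abs_lt_one hz).mul_left (-2 * Real.log (a + 1))
  have h2 := (hasSum_log_sq hz).add h1
  rw [← hasSum_nat_add_iff' 1]
  simp only [Finset.range_one, Finset.sum_singleton, pow_zero, mul_one]
  have hval : Real.log (x + a) ^ 2 - logSqTaylor a 0 =
      Real.log (1 - 1 / (a + 1) * (1 - x)) ^ 2 +
        -2 * Real.log (a + 1) * -Real.log (1 - 1 / (a + 1) * (1 - x)) := by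
    rw [log_add_eq ha hx, logSqTaylor]
    ring
  rw [hval]
  refine h2.congr_fun fun k => ?_
  rw [logSqTaylor_succ, mul_pow]
  ring

theorem continuousOn_log_add_sq {a : ℝ} (ha : 0 < a) :
    ContinuousOn (fun x : ℝ => Real.log (x + a) ^ 2) (Set.Icc 0 1) := by
  refine ContinuousOn.pow (ContinuousOn.log (by fun_prop) fun x hx => ?_) 2
  linarith [hx.1]

theorem betaMoment_eq_one_div {s : ℝ} (hs : NotNegInt s) (k : ℕ) :
    betaMoment k s = 1 / (((k : ℝ) + 1) * genBinom (s + (k + 1)) (k + 1)) := by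
  have h1 : Real.Gamma ((k : ℝ) + 1 + 1) = ((k : ℝ) + 1) * k.factorial := by
    have := Real.Gamma_nat_eq_factorial (k + 1)
    push_cast [Nat.factorial_succ] at this
    exact this
  have h2 : s + ((k : ℝ) + 1) - (k + 1) + 1 = s + 1 := by ring
  have h3 : s + ((k : ℝ) + 1) + 1 = s + k + 2 := by ring
  have h4 : Real.Gamma (s + k + 2) ≠ 0 := by
    have := hs.gamma_ne_zero (k + 1)
    push_cast at this
    convert this using 2; ring
  have h5 : Real.Gamma (s + 1) ≠ 0 := by simpa using hs.gamma_ne_zero 0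
  have h6 : (k.factorial : ℝ) ≠ 0 := by exact_mod_cast k.factorial_ne_zero
  have h7 : (k : ℝ) + 1 ≠ 0 := by positivity
  rw [genBinom, h1, h2, h3, betaMoment]
  field_simp

theorem binomTerm_eq {s : ℝ} (hs : NotNegInt s) (a : ℝ) (k : ℕ) :
    binomTerm s a k = (1 / (a + 1)) ^ (k + 1) / ((k : ℝ) + 1) * betaMoment k s := by
  rw [binomTerm, betaMoment_eq_one_div hs, one_div_pow]
  simp only [sq, mul_inv, div_eq_mul_inv]
  ring

theorem harmonicBinomTerm_eq {s : ℝ} (hs : NotNegInt s) (a : ℝ) (k : ℕ) :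
    harmonicBinomTerm s a k =
      H k * (1 / (a + 1)) ^ (k + 1) / ((k : ℝ) + 1) * betaMoment k s := by
  rw [harmonicBinomTerm, betaMoment_eq_one_div hs, one_div_pow]
  simp only [sq, mul_inv, div_eq_mul_inv]
  ring

theorem summable_binomTerm {s a : ℝ} (hs : NotNegInt s) (ha : 0 < a) :
    Summable (binomTerm s a) :=
  ((geomBounded_pow_div ha).summable_mul_betaMoment hs).congr fun k => (binomTerm_eq hs a k).symm

theorem summable_harmonicBinomTerm {s a : ℝ} (hs : NotNegInt s) (ha : 0 < a) :
    Summable (harmonicBinomTerm s a) :=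
  ((geomBounded_H_mul_pow_div ha).summable_mul_betaMoment hs).congr
    fun k => (harmonicBinomTerm_eq hs a k).symm

theorem hasSum_log_one_sub_sq_div {z u : ℝ} (hz : |z * u| < 1) (hu : u ≠ 0) :
    HasSum (fun k : ℕ => 2 * H k / ((k : ℝ) + 1) * z ^ (k + 1) * u ^ k)
      (Real.log (1 - z * u) ^ 2 / u) := by
  have h := (hasSum_log_sq hz).div_const u
  refine h.congr_fun fun k => ?_
  rw [mul_pow, pow_succ u]
  field_simp

theorem abs_mul_one_sub_lt_one {z x : ℝ} (hz : |z| ≤ 1) (hx : x ∈ Set.Ioo (0 : ℝ) 1) :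
    |z * (1 - x)| < 1 := by
  rw [abs_mul, abs_of_pos (by linarith [hx.2] : 0 < 1 - x)]
  have := hx.1
  have := hx.2
  have := abs_nonneg z
  nlinarith

theorem summable_abs_H_mul_pow_div {z : ℝ} (hz : |z| ≤ 1) :
    Summable fun k : ℕ => |2 * H k / ((k : ℝ) + 1) * z ^ (k + 1)| / ((k : ℝ) + 1) := by
  refine Summable.of_nonneg_of_le (fun k => by positivity) (fun k => ?_)
    (summable_H_div_sq.mul_left 2)
  have h0 := H_nonneg k
  rw [abs_mul, abs_of_nonneg (by positivity), abs_pow]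
  have h1 : |z| ^ (k + 1) ≤ 1 := pow_le_one₀ (abs_nonneg z) hz
  calc 2 * H k / ((k : ℝ) + 1) * |z| ^ (k + 1) / ((k : ℝ) + 1)
      ≤ 2 * H k / ((k : ℝ) + 1) * 1 / ((k : ℝ) + 1) := by gcongr
    _ = _ := by field_simp

/-- The generating function of `H_{k-1} / k²` on `[-1, 1]` as an integral; this is twice the
Nielsen polylogarithm `S_{1,2}`. -/
theorem tsum_H_mul_pow_div {z : ℝ} (hz : |z| ≤ 1) :
    ∑' k : ℕ, 2 * H k / ((k : ℝ) + 1) * z ^ (k + 1) / ((k : ℝ) + 1) =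
      ∫ x in Set.Ioo (0 : ℝ) 1, Real.log (1 - z * (1 - x)) ^ 2 / (1 - x) :=
  (hasSum_integral_powerSeries (fun _ hx => hasSum_log_one_sub_sq_div
    (abs_mul_one_sub_lt_one hz hx) (by linarith [hx.2])) (summable_abs_H_mul_pow_div hz)).tsum_eq

theorem digammaSeries_logSqTaylor {s a : ℝ} (hs : NotNegInt s) (ha : 0 < a) :
    digammaSeries (logSqTaylor a) s =
      (Real.eulerMascheroniConstant + digamma (s + 1)) * Real.log (a + 1) ^ 2
          + 2 * zetaThree
          - Real.log (a + 1) * Real.log (a / (a + 1)) ^ 2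
          - 2 * Real.log (a + 1) * polylog 2 (1 / (a + 1))
          + 2 * Real.log (a / (a + 1)) * polylog 2 (a / (a + 1))
          - 2 * polylog 3 (a / (a + 1))
          + 2 * Real.log (a + 1) * ∑' k : ℕ, binomTerm s a k
          - 2 * ∑' k : ℕ, harmonicBinomTerm s a k := by
  have hy := one_div_add_one_mem ha
  have hyabs : |1 / (a + 1)| ≤ 1 := by rw [abs_of_pos hy.1]; exact hy.2.le
  have hsub : 1 - 1 / (a + 1) = a / (a + 1) := by field_simp; ring
  have h1 := (integral_log_one_sub_sq_div hy)
  rw [← integral_comp_mul_one_sub_div (fun t => Real.log (1 - t) ^ 2) hy.1.ne',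
    ← tsum_H_mul_pow_div hyabs, hsub, Real.log_div one_ne_zero (by positivity), Real.log_one,
    zero_sub] at h1
  have hs1 : Summable fun k : ℕ =>
      2 * H k / ((k : ℝ) + 1) * (1 / (a + 1)) ^ (k + 1) / ((k : ℝ) + 1) := by
    refine Summable.of_norm ((summable_abs_H_mul_pow_div hyabs).congr fun k => ?_)
    rw [Real.norm_eq_abs, abs_div, abs_of_pos (by positivity : (0 : ℝ) < (k : ℝ) + 1)]
  have hs2 : Summable fun k : ℕ => (1 / (a + 1)) ^ (k + 1) / ((k : ℝ) + 1) ^ 2 := by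
    refine Summable.of_norm_bounded (geomBounded_pow_div ha).summable_abs fun k => ?_
    have h0 := hy.1
    rw [Real.norm_eq_abs, abs_of_nonneg (by positivity), abs_of_nonneg (by positivity)]
    have hk : (k : ℝ) + 1 ≤ ((k : ℝ) + 1) ^ 2 := by
      nlinarith [(k.cast_nonneg : (0 : ℝ) ≤ k)]
    gcongr
  have h2 : ∑' k : ℕ, logSqTaylor a (k + 1) / ((k : ℝ) + 1) =
      ∑' k : ℕ, 2 * H k / ((k : ℝ) + 1) * (1 / (a + 1)) ^ (k + 1) / ((k : ℝ) + 1) -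
        2 * Real.log (a + 1) * polylog 2 (1 / (a + 1)) := by
    rw [polylog, ← tsum_mul_left, ← hs1.tsum_sub (hs2.mul_left _)]
    refine tsum_congr fun k => ?_
    rw [logSqTaylor_succ]
    field_simp
  have h3 : ∑' k : ℕ, logSqTaylor a (k + 1) * betaMoment k s =
      2 * ∑' k : ℕ, harmonicBinomTerm s a k -
        2 * Real.log (a + 1) * ∑' k : ℕ, binomTerm s a k := by
    rw [← tsum_mul_left, ← tsum_mul_left, ← ((summable_harmonicBinomTerm hs ha).mul_left _).tsum_sub
      ((summable_binomTerm hs ha).mul_left _)]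
    refine tsum_congr fun k => ?_
    rw [logSqTaylor_succ, binomTerm_eq hs, harmonicBinomTerm_eq hs]
    ring
  rw [digammaSeries, h2, h3, h1, logSqTaylor]
  ring

/-! ### Convergence of the integral -/

/-- If `x ^ s g(x)` is integrable and `g` is at least of the order of `x ^ p` near `0`, then
`x ^ (s + p)` is integrable there. -/
theorem neg_one_lt_of_integrableOn {s p m δ : ℝ} (hm : 0 < m) (hδ0 : 0 < δ) (hδ1 : δ ≤ 1)
    {g : ℝ → ℝ} (hg : ∀ x ∈ Set.Ioo (0 : ℝ) δ, m * x ^ p ≤ g x)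
    (h : IntegrableOn (fun x => x ^ s * g x) (Set.Ioo 0 1)) : -1 < s + p := by
  rw [← intervalIntegral.integrableOn_Ioo_rpow_iff hδ0]
  have h1 : IntegrableOn (fun x => m⁻¹ * (x ^ s * g x)) (Set.Ioo 0 δ) :=
    (h.mono_set (Set.Ioo_subset_Ioo_right hδ1)).const_mul _
  refine Integrable.mono' h1 (ContinuousOn.aestronglyMeasurable (fun x hx =>
    (Real.continuousAt_rpow_const x _ (Or.inl hx.1.ne')).continuousWithinAt) measurableSet_Ioo) ?_
  filter_upwards [ae_restrict_mem measurableSet_Ioo] with x hx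
  have h2 := hg x hx
  have h3 : 0 < x ^ s := Real.rpow_pos_of_pos hx.1 s
  rw [Real.norm_eq_abs, abs_of_pos (Real.rpow_pos_of_pos hx.1 _), Real.rpow_add hx.1]
  calc x ^ s * x ^ p = m⁻¹ * (x ^ s * (m * x ^ p)) := by field_simp
    _ ≤ _ := by gcongr

theorem log_add_one_le {x : ℝ} (hx : 0 ≤ x) : 0 ≤ Real.log (x + 1) ∧ Real.log (x + 1) ≤ x :=
  ⟨Real.log_nonneg (by linarith), by
    have := Real.log_le_sub_one_of_pos (by linarith : 0 < x + 1); linarith⟩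

/-- The logarithm `log (x + a)` vanishes at `x = 0` only for `a = 1`, and then to first order, which
moves the threshold from `-1` to `-3`. -/
theorem integrableOn_rpow_mul_log_add_sq_iff {s a : ℝ} (ha : 0 < a) :
    IntegrableOn (fun x => x ^ s * Real.log (x + a) ^ 2) (Set.Ioo 0 1) ↔
      -1 < s ∨ (a = 1 ∧ -3 < s) := by
  constructor
  · intro h
    rcases eq_or_ne a 1 with rfl | ha1
    · right
      refine ⟨rfl, ?_⟩
      have := neg_one_lt_of_integrableOn (p := 2) (m := 1 / 4) (δ := 1) (by norm_num) one_pos le_rfl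
        (fun x hx => ?_) h
      · linarith
      · have h0 := hx.1
        have h1 := Real.one_sub_inv_le_log_of_pos (by linarith : 0 < x + 1)
        have h2 : x / 2 ≤ 1 - (x + 1)⁻¹ := by
          have : 1 - (x + 1)⁻¹ = x / (x + 1) := by field_simp; ring
          rw [this]
          gcongr
          linarith [hx.2]
        have h3 : (x / 2) ^ 2 ≤ Real.log (x + 1) ^ 2 := by gcongr; linarith
        rw [Real.rpow_two]
        linarith
    · left
      have hne : Real.log a ≠ 0 := Real.log_ne_zero_of_pos_of_ne_one ha ha1
      have hpos : 0 < Real.log a ^ 2 := by positivity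
      have hc : ContinuousAt (fun x : ℝ => Real.log (x + a) ^ 2) 0 := by
        refine ContinuousAt.pow (ContinuousAt.log (by fun_prop) ?_) 2
        simpa using ha.ne'
      have hev : ∀ᶠ x in nhds (0 : ℝ), Real.log a ^ 2 / 2 < Real.log (x + a) ^ 2 :=
        hc.eventually_const_lt (by simp only [zero_add]; linarith)
      obtain ⟨ε, hε, hball⟩ := Metric.eventually_nhds_iff.1 hev
      have := neg_one_lt_of_integrableOn (p := 0) (m := Real.log a ^ 2 / 2) (δ := min ε 1)
        (by positivity) (by positivity) (min_le_right _ _) (fun x hx => ?_) h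
      · linarith
      · rw [Real.rpow_zero, mul_one]
        refine (hball ?_).le
        rw [Real.dist_eq, sub_zero, abs_of_pos hx.1]
        exact hx.2.trans_le (min_le_left _ _)
  · rintro (hs | ⟨rfl, hs⟩)
    · exact integrableOn_rpow_mul_continuousOn hs (continuousOn_log_add_sq ha)
    · refine Integrable.mono' (integrableOn_rpow (by linarith : -1 < s + 2))
        (((continuousOn_rpow_Ioo s).mul ((continuousOn_log_add_sq ha).mono
          Set.Ioo_subset_Icc_self)).aestronglyMeasurable measurableSet_Ioo) ?_
      filter_upwards [ae_restrict_mem measurableSet_Ioo] with x hx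
      have h1 := log_add_one_le hx.1.le
      have h2 : 0 ≤ x ^ s := Real.rpow_nonneg hx.1.le s
      rw [Real.norm_eq_abs, abs_of_nonneg (by positivity), Real.rpow_add hx.1, Real.rpow_two]
      gcongr
      · exact h1.1
      · exact h1.2

/-! ### The range `-3 < s < -1` for `a = 1` -/

theorem tsum_logSqTaylor {a x : ℝ} (ha : 0 < a) (hx : x ∈ Set.Icc (0 : ℝ) 1) :
    Real.log (x + a) ^ 2 = ∑' k, logSqTaylor a k * (1 - x) ^ k :=
  (hasSum_logSqTaylor ha hx).tsum_eq.symm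

theorem tsum_logSqTaylor_one : ∑' k, logSqTaylor 1 k = 0 := by
  have := tsum_logSqTaylor one_pos (x := 0) ⟨le_rfl, zero_le_one⟩
  simpa using this.symm

/-- `log² (1 + x)` vanishes to second order at `x = 0`, so the power series of its quotient by `x`
still vanishes there. -/
theorem tsum_partialSums_logSqTaylor_one : ∑' k, partialSums (logSqTaylor 1) k = 0 := by
  have hc := geomBounded_logSqTaylor one_pos
  have hd := hc.partialSums tsum_logSqTaylor_one
  set φ : ℝ → ℝ := fun u => ∑' k, partialSums (logSqTaylor 1) k * u ^ k with hφ
  have h1 : Filter.Tendsto (fun x : ℝ => φ (1 - x)) (nhdsWithin 0 (Set.Ioo 0 1))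
      (nhds (φ 1)) := by
    have hcont : ContinuousWithinAt φ (Set.Icc 0 1) (1 - 0) := by
      rw [sub_zero]; exact hd.continuousOn_tsum 1 ⟨zero_le_one, le_rfl⟩
    have := hcont.comp (t := Set.Icc 0 1) (s := Set.Ioo 0 1) (f := fun x : ℝ => 1 - x) (x := 0)
      (by fun_prop) fun x hx => ⟨by linarith [hx.2], by linarith [hx.1]⟩
    simpa [ContinuousWithinAt, Function.comp_def] using this
  have hle : ∀ x ∈ Set.Ioo (0 : ℝ) 1, 0 ≤ φ (1 - x) ∧ φ (1 - x) ≤ x := by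
    intro x hx
    have h2 := hc.tsum_mul_pow_eq tsum_logSqTaylor_one (u := 1 - x)
      ⟨by linarith [hx.2], by linarith [hx.1]⟩
    rw [← tsum_logSqTaylor one_pos (Set.Ioo_subset_Icc_self hx), sub_sub_cancel] at h2
    change _ = x * φ (1 - x) at h2
    have h3 := log_add_one_le hx.1.le
    have h4 : Real.log (x + 1) ^ 2 ≤ x ^ 2 := by gcongr <;> simp [h3]
    have h5 := sq_nonneg (Real.log (x + 1))
    have h0 := hx.1
    constructor
    · by_contra hneg
      nlinarith
    · by_contra hneg
      nlinarith
  have hmem : ∀ᶠ x in nhdsWithin (0 : ℝ) (Set.Ioo 0 1), x ∈ Set.Ioo (0 : ℝ) 1 :=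
    self_mem_nhdsWithin
  have h2 : Filter.Tendsto (fun x : ℝ => φ (1 - x)) (nhdsWithin 0 (Set.Ioo 0 1)) (nhds 0) := by
    refine tendsto_of_tendsto_of_tendsto_of_le_of_le' tendsto_const_nhds
      (tendsto_nhdsWithin_of_tendsto_nhds Filter.tendsto_id) ?_ ?_
    · filter_upwards [hmem] with x hx using (hle x hx).1
    · filter_upwards [hmem] with x hx using (hle x hx).2
  have hne : (nhdsWithin (0 : ℝ) (Set.Ioo 0 1)).NeBot := by
    rw [← mem_closure_iff_nhdsWithin_neBot, closure_Ioo zero_ne_one]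
    exact ⟨le_rfl, zero_le_one⟩
  have := tendsto_nhds_unique h1 h2
  simpa [hφ] using this

theorem integral_rpow_mul_log_add_one_sq {s : ℝ} (hn : NotNegInt s) (hs : -3 < s) :
    ∫ x in Set.Ioo (0 : ℝ) 1, x ^ s * Real.log (x + 1) ^ 2 =
      ∑' k, logSqTaylor 1 k * betaMoment k s := by
  have hc := geomBounded_logSqTaylor one_pos
  have hd := hc.partialSums tsum_logSqTaylor_one
  have he := hd.partialSums tsum_partialSums_logSqTaylor_one
  have h : ∫ x in Set.Ioo (0 : ℝ) 1, x ^ s * Real.log (x + 1) ^ 2 =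
      ∫ x in Set.Ioo (0 : ℝ) 1, x ^ s * ∑' k, logSqTaylor 1 k * (1 - x) ^ k := by
    refine setIntegral_congr_fun measurableSet_Ioo fun x hx => ?_
    rw [tsum_logSqTaylor one_pos (Set.Ioo_subset_Icc_self hx)]
  rw [h]
  exact hc.integral_rpow_mul_of_zero tsum_logSqTaylor_one hn
    (hd.integral_rpow_mul_of_zero tsum_partialSums_logSqTaylor_one hn.add_one
      (he.integral_rpow_mul (by linarith)))

theorem integral_digammaKernel_mul_log_add_sq {s a : ℝ} (hn : NotNegInt s) (ha : 0 < a)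
    (h : -1 < s ∨ (a = 1 ∧ -3 < s)) :
    ∫ x in Set.Ioo (0 : ℝ) 1, digammaKernel s x * Real.log (x + a) ^ 2 =
      digammaSeries (logSqTaylor a) s := by
  have base : ∀ s a : ℝ, 0 < a → -1 < s →
      ∫ x in Set.Ioo (0 : ℝ) 1, digammaKernel s x * Real.log (x + a) ^ 2 =
        digammaSeries (logSqTaylor a) s := fun s a ha hs =>
    (geomBounded_logSqTaylor ha).integral_digammaKernel_mul hs (continuousOn_log_add_sq ha)
      fun x hx => tsum_logSqTaylor ha hx
  have step : ∀ s : ℝ, NotNegInt s → -3 < s →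
      ∫ x in Set.Ioo (0 : ℝ) 1, digammaKernel (s + 1) x * Real.log (x + 1) ^ 2 =
        digammaSeries (logSqTaylor 1) (s + 1) →
      ∫ x in Set.Ioo (0 : ℝ) 1, digammaKernel s x * Real.log (x + 1) ^ 2 =
        digammaSeries (logSqTaylor 1) s := fun s hn hs ih =>
    (geomBounded_logSqTaylor one_pos).integral_digammaKernel_mul_descend hn
      (continuousOn_log_add_sq one_pos)
      ((integrableOn_rpow_mul_log_add_sq_iff one_pos).2 (Or.inr ⟨rfl, hs⟩))
      (integral_rpow_mul_log_add_one_sq hn hs) ih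
  rcases h with hs | ⟨rfl, hs⟩
  · exact base s a ha hs
  · exact step s hn hs (step (s + 1) hn.add_one (by linarith)
      (base (s + 1 + 1) 1 one_pos (by linarith)))

/-! ### The weight `log (a - x)` -/

theorem sum_Icc_one_eq_sum_range (f : ℕ → ℝ) (n : ℕ) :
    ∑ k ∈ Finset.Icc 1 n, f k = ∑ i ∈ Finset.range n, f (i + 1) := by
  induction n with
  | zero => simp
  | succ n ih => rw [Finset.sum_Icc_succ_top (by omega), Finset.sum_range_succ, ih]

theorem log_sub_sub_log_eq {a x : ℝ} (ha : 1 < a) (hx : x ∈ Set.Icc (0 : ℝ) 1) :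
    Real.log (a - x) - Real.log (a - 1) = Real.log (1 + 1 / (a - 1) * (1 - x)) := by
  have h1 : a - 1 ≠ 0 := by linarith
  rw [← Real.log_div (by linarith [hx.2]) h1]
  congr 1
  field_simp
  ring

theorem continuousOn_log_sub {a : ℝ} (ha : 1 < a) :
    ContinuousOn (fun x : ℝ => Real.log (a - x)) (Set.Icc 0 1) :=
  ContinuousOn.log (by fun_prop) fun x hx => by linarith [hx.2]

/-- Integration by parts with the primitive `(x ^ (n + 1) - a ^ (n + 1)) / (n + 1)` of `x ^ n`,
which cancels the pole of the derivative of the logarithm at `x = a`. -/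
theorem integral_pow_mul_log_sub {a : ℝ} (ha : 1 < a) (n : ℕ) :
    ∫ x in Set.Ioo (0 : ℝ) 1, x ^ n * (Real.log (a - x) - Real.log (a - 1)) =
      a ^ (n + 1) / ((n : ℝ) + 1) * Real.log (a / (a - 1)) -
        1 / ((n : ℝ) + 1) * ∑ j ∈ Finset.range (n + 1), a ^ (n - j) / ((j : ℝ) + 1) := by
  have hn : (n : ℝ) + 1 ≠ 0 := by positivity
  set F : ℝ → ℝ := fun x =>
    (x ^ (n + 1) - a ^ (n + 1)) / ((n : ℝ) + 1) * (Real.log (a - x) - Real.log (a - 1)) -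
      1 / ((n : ℝ) + 1) * ∑ j ∈ Finset.range (n + 1), a ^ (n - j) * (x ^ (j + 1) / ((j : ℝ) + 1))
    with hF
  have hd : ∀ x ∈ Set.uIcc (0 : ℝ) 1,
      HasDerivAt F (x ^ n * (Real.log (a - x) - Real.log (a - 1))) x := by
    intro x hx
    rw [Set.uIcc_of_le zero_le_one] at hx
    have hax : a - x ≠ 0 := by linarith [hx.2]
    have h1 : HasDerivAt (fun x : ℝ => (x ^ (n + 1) - a ^ (n + 1)) / ((n : ℝ) + 1)) (x ^ n) x := by
      refine (((hasDerivAt_pow (n + 1) x).sub_const _).div_const _).congr_deriv ?_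
      push_cast
      field_simp
    have h2 : HasDerivAt (fun x : ℝ => Real.log (a - x) - Real.log (a - 1)) (-1 / (a - x)) x :=
      (((hasDerivAt_id x).const_sub a).log hax).sub_const _
    have h3 : HasDerivAt (fun x : ℝ =>
        ∑ j ∈ Finset.range (n + 1), a ^ (n - j) * (x ^ (j + 1) / ((j : ℝ) + 1)))
        (∑ j ∈ Finset.range (n + 1), a ^ (n - j) * x ^ j) x := by
      refine HasDerivAt.fun_sum fun j _ => ?_
      refine (((hasDerivAt_pow (j + 1) x).div_const ((j : ℝ) + 1)).const_mul
        (a ^ (n - j))).congr_deriv ?_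
      have : (j : ℝ) + 1 ≠ 0 := by positivity
      push_cast
      field_simp
    refine ((h1.mul h2).sub (h3.const_mul (1 / ((n : ℝ) + 1)))).congr_deriv ?_
    have h4 := geom_sum₂_mul x a (n + 1)
    have h5 : ∑ j ∈ Finset.range (n + 1), a ^ (n - j) * x ^ j =
        ∑ j ∈ Finset.range (n + 1), x ^ j * a ^ (n + 1 - 1 - j) :=
      Finset.sum_congr rfl fun j _ => by rw [add_tsub_cancel_right, mul_comm]
    rw [h5, ← h4]
    field_simp
    ring
  have hcont : ContinuousOn (fun x : ℝ => x ^ n * (Real.log (a - x) - Real.log (a - 1)))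
      (Set.uIcc 0 1) := by
    rw [Set.uIcc_of_le zero_le_one]
    exact (continuousOn_pow n).mul ((continuousOn_log_sub ha).sub continuousOn_const)
  rw [← integral_Ioc_eq_integral_Ioo, ← intervalIntegral.integral_of_le zero_le_one,
    intervalIntegral.integral_eq_sub_of_hasDerivAt hd hcont.intervalIntegrable,
    Real.log_div (by linarith) (by linarith)]
  have hz : ∀ j : ℕ, (0 : ℝ) ^ (j + 1) = 0 := fun j => zero_pow (by omega)
  simp only [hF, hz, one_pow, sub_zero, sub_self, mul_zero, zero_div, Finset.sum_const_zero,
    mul_one_div]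
  ring

/-- The increment in `n` of the finite harmonic sum matches the sum produced by
`integral_pow_mul_log_sub`. -/
theorem sum_H_mul_pow_succ (a : ℝ) (n : ℕ) :
    ∑ k ∈ Finset.Icc 1 (n + 1), (H k + H (n + 1 - k) - H (n + 1)) * a ^ k / (k : ℝ) +
        1 / ((n : ℝ) + 1) ^ 2 =
      ∑ k ∈ Finset.Icc 1 n, (H k + H (n - k) - H n) * a ^ k / (k : ℝ) +
        1 / ((n : ℝ) + 1) * ∑ j ∈ Finset.range (n + 1), a ^ (n - j) / ((j : ℝ) + 1) := by
  have h1 : ∑ j ∈ Finset.range (n + 1), a ^ (n - j) / ((j : ℝ) + 1) =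
      ∑ k ∈ Finset.Icc 1 n, a ^ k / ((n : ℝ) - k + 1) + 1 / ((n : ℝ) + 1) := by
    rw [← Finset.sum_range_reflect, Finset.sum_range_succ', sum_Icc_one_eq_sum_range]
    congr 1
    · refine Finset.sum_congr rfl fun i hi => ?_
      have hi' : i + 1 ≤ n := Finset.mem_range.1 hi
      have e1 : n - (n + 1 - 1 - (i + 1)) = i + 1 := by omega
      have e2 : n + 1 - 1 - (i + 1) = n - (i + 1) := by omega
      rw [e1, e2, Nat.cast_sub hi']
    · simp
  have h2 : ∑ k ∈ Finset.Icc 1 n, (H k + H (n + 1 - k) - H (n + 1)) * a ^ k / (k : ℝ) =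
      ∑ k ∈ Finset.Icc 1 n, (H k + H (n - k) - H n) * a ^ k / (k : ℝ) +
        1 / ((n : ℝ) + 1) * ∑ k ∈ Finset.Icc 1 n, a ^ k / ((n : ℝ) - k + 1) := by
    rw [Finset.mul_sum, ← Finset.sum_add_distrib]
    refine Finset.sum_congr rfl fun k hk => ?_
    obtain ⟨hk1, hkn⟩ := Finset.mem_Icc.1 hk
    have e1 : n + 1 - k = (n - k) + 1 := by omega
    have hk0 : (k : ℝ) ≠ 0 := by exact_mod_cast (by omega : k ≠ 0)
    have hn0 : (n : ℝ) + 1 ≠ 0 := by positivity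
    have hnk : (n : ℝ) - k + 1 ≠ 0 := by
      have : (k : ℝ) ≤ n := by exact_mod_cast hkn
      linarith
    rw [e1, H_succ, H_succ, Nat.cast_sub hkn]
    field_simp
    ring
  rw [Finset.sum_Icc_succ_top (by omega), Nat.sub_self, H_zero, h1, h2]
  generalize ∑ k ∈ Finset.Icc 1 n, (H k + H (n - k) - H n) * a ^ k / (k : ℝ) = S
  have h3 : 1 / ((n : ℝ) + 1) ^ 2 = 1 / ((n : ℝ) + 1) * (1 / ((n : ℝ) + 1)) := by
    rw [one_div_mul_one_div, sq]
  rw [h3]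
  ring

theorem integral_digammaKernel_mul_log_sub {a : ℝ} (ha : 1 < a) (n : ℕ) :
    ∫ x in Set.Ioo (0 : ℝ) 1,
        digammaKernel n x * (Real.log (a - x) - Real.log (a - 1)) =
      Real.log (a / (a - 1)) * ∑ k ∈ Finset.Icc 1 n, a ^ k / (k : ℝ) - genHarmonic 2 n -
        ∑ k ∈ Finset.Icc 1 n, (H k + H (n - k) - H n) * a ^ k / (k : ℝ) := by
  have hc : ContinuousOn (fun x : ℝ => Real.log (a - x) - Real.log (a - 1)) (Set.Icc 0 1) :=
    (continuousOn_log_sub ha).sub continuousOn_const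
  induction n with
  | zero => simp [digammaKernel, genHarmonic]
  | succ n ih =>
    have hn : (-1 : ℝ) < n := by linarith [(n.cast_nonneg : (0 : ℝ) ≤ n)]
    have h1 := integral_digammaKernel_mul_eq_add_one_sub
      (integrableOn_digammaKernel_mul (by linarith : (-1 : ℝ) < n + 1) hc)
      (integrableOn_rpow_mul_continuousOn hn hc)
    simp only [Real.rpow_natCast] at h1
    rw [ih, integral_pow_mul_log_sub ha] at h1
    have h2 := sum_H_mul_pow_succ a n
    rw [Finset.sum_Icc_succ_top (f := fun k => a ^ k / (k : ℝ)) (by omega), genHarmonic_succ]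
    push_cast
    linarith

theorem betaMoment_nat (k n : ℕ) :
    betaMoment k n = 1 / (((k : ℝ) + 1) * ((n + (k + 1)).choose (k + 1) : ℝ)) := by
  have h1 : Real.Gamma ((n : ℝ) + k + 2) = (n + (k + 1)).factorial := by
    rw [← Real.Gamma_nat_eq_factorial]; push_cast; ring_nf
  have h2 : (((n + (k + 1)).choose (k + 1) : ℕ) : ℝ) * (k + 1).factorial * n.factorial =
      (n + (k + 1)).factorial := by
    have := Nat.choose_mul_factorial_mul_factorial (Nat.le_add_left (k + 1) n)
    rw [Nat.add_sub_cancel] at this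
    exact_mod_cast this
  have h3 : (((n + (k + 1)).choose (k + 1) : ℕ) : ℝ) ≠ 0 := by
    exact_mod_cast (Nat.choose_pos (Nat.le_add_left (k + 1) n)).ne'
  have h4 : (n.factorial : ℝ) ≠ 0 := by exact_mod_cast n.factorial_ne_zero
  have h5 : (k.factorial : ℝ) ≠ 0 := by exact_mod_cast k.factorial_ne_zero
  have h6 : (k : ℝ) + 1 ≠ 0 := by positivity
  rw [betaMoment, h1, ← h2, Real.Gamma_nat_eq_factorial, Nat.factorial_succ]
  push_cast
  field_simp

theorem altHarmonicBinomTerm_eq (n : ℕ) (a : ℝ) (k : ℕ) :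
    altHarmonicBinomTerm n a k =
      2 * H k / ((k : ℝ) + 1) * (-(1 / (a - 1))) ^ (k + 1) * betaMoment k n := by
  rw [altHarmonicBinomTerm, betaMoment_nat, neg_pow (1 / (a - 1)), one_div_pow]
  simp only [sq, mul_inv, div_eq_mul_inv]
  ring

theorem abs_neg_one_div_sub_one_le {a : ℝ} (ha : 2 ≤ a) : |-(1 / (a - 1))| ≤ 1 := by
  rw [abs_neg, abs_of_pos (by apply one_div_pos.2; linarith), div_le_one (by linarith)]
  linarith

theorem summable_abs_mul_betaMoment_nat {z : ℝ} (hz : |z| ≤ 1) (n : ℕ) :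
    Summable fun k : ℕ => |2 * H k / ((k : ℝ) + 1) * z ^ (k + 1)| * betaMoment k n := by
  have hn : (0 : ℝ) ≤ n := n.cast_nonneg
  refine Summable.of_nonneg_of_le
    (fun k => mul_nonneg (abs_nonneg _) (betaMoment_nonneg (by linarith) k)) (fun k => ?_)
    (summable_abs_H_mul_pow_div hz)
  calc _ ≤ |2 * H k / ((k : ℝ) + 1) * z ^ (k + 1)| * (1 / ((k : ℝ) + 1)) := by
        gcongr; exact betaMoment_le_of_nonneg hn k
    _ = _ := by rw [mul_one_div]

theorem summable_altHarmonicBinomTerm {a : ℝ} (ha : 2 ≤ a) (n : ℕ) :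
    Summable (altHarmonicBinomTerm n a) := by
  have hn : (0 : ℝ) ≤ n := n.cast_nonneg
  refine Summable.of_norm
    ((summable_abs_mul_betaMoment_nat (abs_neg_one_div_sub_one_le ha) n).congr fun k => ?_)
  rw [altHarmonicBinomTerm_eq, Real.norm_eq_abs, abs_mul _ (betaMoment k n),
    abs_of_nonneg (betaMoment_nonneg (by linarith) k)]

theorem integral_digammaKernel_mul_log_sub_sub_sq {a : ℝ} (ha : 2 ≤ a) (n : ℕ) :
    ∫ x in Set.Ioo (0 : ℝ) 1,
        digammaKernel n x * (Real.log (a - x) - Real.log (a - 1)) ^ 2 =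
      2 * zetaThree - Real.log (a - 1) * Real.log (a / (a - 1)) ^ 2
        - 2 / 3 * Real.log (a / (a - 1)) ^ 3 - 2 * polylog 3 ((a - 1) / a)
        - 2 * Real.log (a / (a - 1)) * polylog 2 ((a - 1) / a)
        - ∑' k : ℕ, altHarmonicBinomTerm n a k := by
  have hn : (0 : ℝ) ≤ n := n.cast_nonneg
  have ha1 : 1 < a := by linarith
  have hpos : 0 < 1 / (a - 1) := one_div_pos.2 (by linarith)
  have hz := abs_neg_one_div_sub_one_le ha
  have hc : ContinuousOn (fun x : ℝ => (Real.log (a - x) - Real.log (a - 1)) ^ 2) (Set.Icc 0 1) :=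
    ((continuousOn_log_sub ha1).sub continuousOn_const).pow 2
  have hlog : ∀ x ∈ Set.Ioo (0 : ℝ) 1, Real.log (a - x) - Real.log (a - 1) =
      Real.log (1 - -(1 / (a - 1)) * (1 - x)) := by
    intro x hx
    rw [log_sub_sub_log_eq ha1 (Set.Ioo_subset_Icc_self hx)]
    ring_nf
  rw [integral_digammaKernel_mul_powerSeries (c₀ := 0) (by linarith) hc (fun x hx => by
      rw [sub_zero, hlog x hx]
      exact hasSum_log_one_sub_sq_div (abs_mul_one_sub_lt_one hz hx) (by linarith [hx.2]))
    (summable_abs_H_mul_pow_div hz) (summable_abs_mul_betaMoment_nat hz n),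
    tsum_H_mul_pow_div hz, ← tsum_congr (altHarmonicBinomTerm_eq n a)]
  have h1 : ∫ x in Set.Ioo (0 : ℝ) 1, Real.log (1 - -(1 / (a - 1)) * (1 - x)) ^ 2 / (1 - x) =
      ∫ x in Set.Ioo (0 : ℝ) 1, Real.log (1 + 1 / (a - 1) * (1 - x)) ^ 2 / (1 - x) := by
    simp only [neg_mul, sub_neg_eq_add]
  have hne : a - 1 ≠ 0 := by linarith
  have e1 : 1 + 1 / (a - 1) = a / (a - 1) := by field_simp; ring
  rw [h1, integral_comp_mul_one_sub_div (fun t => Real.log (1 + t) ^ 2) hpos.ne',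
    integral_log_one_add_sq_div hpos, e1, one_div_div, Real.log_div one_ne_zero hne, Real.log_one]
  ring

theorem integral_digammaKernel_mul_log_sub_sq {a : ℝ} (ha : 2 ≤ a) (n : ℕ) :
    ∫ x in Set.Ioo (0 : ℝ) 1, digammaKernel n x * Real.log (a - x) ^ 2 =
      H n * Real.log (a - 1) ^ 2
        + 2 * zetaThree
        - 2 * genHarmonic 2 n * Real.log (a - 1)
        - 2 * Real.log (a - 1) *
            ∑ k ∈ Finset.Icc 1 n, (H k + H (n - k) - H n) * a ^ k / (k : ℝ)
        - Real.log (a - 1) * Real.log (a / (a - 1)) ^ 2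
        - 2 / 3 * Real.log (a / (a - 1)) ^ 3
        - 2 * polylog 3 ((a - 1) / a)
        - 2 * Real.log (a / (a - 1)) * polylog 2 ((a - 1) / a)
        - ∑' k : ℕ, altHarmonicBinomTerm n a k
        + 2 * Real.log (a - 1) * Real.log (a / (a - 1)) *
            ∑ k ∈ Finset.Icc 1 n, a ^ k / (k : ℝ) := by
  have hn : (-1 : ℝ) < n := by linarith [(n.cast_nonneg : (0 : ℝ) ≤ n)]
  have ha1 : 1 < a := by linarith
  have hc : ContinuousOn (fun x : ℝ => Real.log (a - x) - Real.log (a - 1)) (Set.Icc 0 1) :=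
    (continuousOn_log_sub ha1).sub continuousOn_const
  have i0 := (integrableOn_digammaKernel hn).const_mul (Real.log (a - 1) ^ 2)
  have i1 := (integrableOn_digammaKernel_mul hn hc).const_mul (2 * Real.log (a - 1))
  have i2 : IntegrableOn
      (fun x => digammaKernel n x * (Real.log (a - x) - Real.log (a - 1)) ^ 2) (Set.Ioo 0 1) :=
    integrableOn_digammaKernel_mul hn (hc.pow 2)
  have hsplit : ∫ x in Set.Ioo (0 : ℝ) 1, digammaKernel n x * Real.log (a - x) ^ 2 =
      Real.log (a - 1) ^ 2 * (∫ x in Set.Ioo (0 : ℝ) 1, digammaKernel n x) +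
        2 * Real.log (a - 1) * (∫ x in Set.Ioo (0 : ℝ) 1,
          digammaKernel n x * (Real.log (a - x) - Real.log (a - 1))) +
        ∫ x in Set.Ioo (0 : ℝ) 1,
          digammaKernel n x * (Real.log (a - x) - Real.log (a - 1)) ^ 2 := by
    rw [← integral_const_mul, ← integral_const_mul, ← integral_add i0 i1,
      ← integral_add (by exact i0.add i1) i2]
    refine setIntegral_congr_fun measurableSet_Ioo fun x _ => ?_
    ring
  rw [hsplit, integral_digammaKernel_nat, integral_digammaKernel_mul_log_sub ha1,
    integral_digammaKernel_mul_log_sub_sub_sq ha]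
  ring

theorem theorem2p7 :
    (∀ s a : ℝ, (∀ m : ℕ, 1 ≤ m → s ≠ -(m : ℝ)) → 0 < a →
      Summable (binomTerm s a) ∧ Summable (harmonicBinomTerm s a) ∧
      (IntervalIntegrable (fun x : ℝ => (1 - x ^ s) / (1 - x) * Real.log (x + a) ^ 2) volume 0 1 ↔
        -1 < s ∨ (a = 1 ∧ -3 < s)) ∧
      (IntervalIntegrable (fun x : ℝ => (1 - x ^ s) / (1 - x) * Real.log (x + a) ^ 2) volume 0 1 →
        ∫ x in (0 : ℝ)..1, (1 - x ^ s) / (1 - x) * Real.log (x + a) ^ 2 =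
          (Real.eulerMascheroniConstant + digamma (s + 1)) * Real.log (a + 1) ^ 2
          + 2 * zetaThree
          - Real.log (a + 1) * Real.log (a / (a + 1)) ^ 2
          - 2 * Real.log (a + 1) * polylog 2 (1 / (a + 1))
          + 2 * Real.log (a / (a + 1)) * polylog 2 (a / (a + 1))
          - 2 * polylog 3 (a / (a + 1))
          + 2 * Real.log (a + 1) * ∑' k : ℕ, binomTerm s a k
          - 2 * ∑' k : ℕ, harmonicBinomTerm s a k)) ∧
    (∀ (n : ℕ) (a : ℝ), 2 ≤ a →
      Summable (altHarmonicBinomTerm n a) ∧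
      IntervalIntegrable (fun x : ℝ => (1 - x ^ n) / (1 - x) * Real.log (a - x) ^ 2) volume 0 1 ∧
      ∫ x in (0 : ℝ)..1, (1 - x ^ n) / (1 - x) * Real.log (a - x) ^ 2 =
        H n * Real.log (a - 1) ^ 2
        + 2 * zetaThree
        - 2 * genHarmonic 2 n * Real.log (a - 1)
        - 2 * Real.log (a - 1) *
            ∑ k ∈ Finset.Icc 1 n, (H k + H (n - k) - H n) * a ^ k / (k : ℝ)
        - Real.log (a - 1) * Real.log (a / (a - 1)) ^ 2
        - 2 / 3 * Real.log (a / (a - 1)) ^ 3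
        - 2 * polylog 3 ((a - 1) / a)
        - 2 * Real.log (a / (a - 1)) * polylog 2 ((a - 1) / a)
        - ∑' k : ℕ, altHarmonicBinomTerm n a k
        + 2 * Real.log (a - 1) * Real.log (a / (a - 1)) *
            ∑ k ∈ Finset.Icc 1 n, a ^ k / (k : ℝ)) := by
  refine ⟨fun s a hs ha => ?_, fun n a ha => ?_⟩
  · have hs' : NotNegInt s := hs
    have hiff : IntervalIntegrable
        (fun x : ℝ => (1 - x ^ s) / (1 - x) * Real.log (x + a) ^ 2) volume 0 1 ↔
        -1 < s ∨ (a = 1 ∧ -3 < s) := by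
      rw [intervalIntegrable_iff_integrableOn_Ioo_of_le zero_le_one,
        ← integrableOn_rpow_mul_log_add_sq_iff ha]
      exact integrableOn_digammaKernel_mul_iff s (continuousOn_log_add_sq ha)
    refine ⟨summable_binomTerm hs' ha, summable_harmonicBinomTerm hs' ha, hiff, fun hint => ?_⟩
    rw [← digammaSeries_logSqTaylor hs' ha, intervalIntegral.integral_of_le zero_le_one,
      integral_Ioc_eq_integral_Ioo]
    exact integral_digammaKernel_mul_log_add_sq hs' ha (hiff.1 hint)
  · have hn : (-1 : ℝ) < n := by linarith [(n.cast_nonneg : (0 : ℝ) ≤ n)]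
    have hfun : (fun x : ℝ => (1 - x ^ n) / (1 - x) * Real.log (a - x) ^ 2) =
        fun x => digammaKernel n x * Real.log (a - x) ^ 2 := by
      funext x
      rw [digammaKernel, Real.rpow_natCast]
    refine ⟨summable_altHarmonicBinomTerm ha n, ?_, ?_⟩
    · rw [hfun, intervalIntegrable_iff_integrableOn_Ioo_of_le zero_le_one]
      exact integrableOn_digammaKernel_mul hn ((continuousOn_log_sub (by linarith)).pow 2)
    · rw [hfun, intervalIntegral.integral_of_le zero_le_one, integral_Ioc_eq_integral_Ioo]
      exact integral_digammaKernel_mul_log_sub_sq ha n
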